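/- Let $E\subseteq\mathbb{R}^n$ be a nonempty (otherwise arbitrary) set, let $X\subseteq\mathbb{R}^n$ be a linear subspace with orthogonal projection $P:\mathbb{R}^n\to X$, and let $f:E\to\mathbb{R}$ and $G:E\to\mathbb{R}^n$ be functions. A function $c:X\to\mathbb{R}$ is called essentially coercive if there is a linear function $\ell:X\to\mathbb{R}$ such that $c(x_k)-\ell(x_k)\to+\infty$ for every sequence $(x_k)_k\subset X$ with $|x_k|\to\infty$. For a convex function $F:\mathbb{R}^n\to\mathbb{R}$, $X_F$ denotes the unique linear subspace of $\mathbb{R}^n$ for which there are a vector $v\in X_F^{\perp}$ and an essentially coercive function $c:X_F\to\mathbb{R}$ with $F(x)=c(P_{X_F}(x))+\langle v,x\rangle$ for all $x\in\mathbb{R}^n$, where $P_{X_F}$ is the orthogonal projection onto $X_F$. There exists a convex function $F:\mathbb{R}^n\to\mathbb{R}$ of class $C^1$ such that $F|_E=f$, $(\nabla F)|_E=G$ and $X_F=X$ if and only if the following conditions are satisfied. (i) $G$ is continuous and $f(x)\ge f(y)+\langle G(y),x-y\rangle$ for all $x,y\in E$. (ii) If $(x_k)_k\subset E$ is a sequence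 with $\lim_{k\to\infty}|G(x_k)|=+\infty$, then $$\lim_{k\to\infty}\frac{\langle G(x_k),x_k\rangle-f(x_k)}{|G(x_k)|}=+\infty.$$ (iii) $Y:=\operatorname{span}\{G(x)-G(y):x,y\in E\}\subseteq X$. (iv) If $Y\ne X$ and $k=\dim Y$, $d=\dim X$, then there exist points $p_1,\dots,p_{d-k}\in\mathbb{R}^n\setminus\overline{E}$, numbers $\beta_1,\dots,\beta_{d-k}\in\mathbb{R}$ and vectors $w_1,\dots,w_{d-k}\in\mathbb{R}^n$ such that (with $\sup\emptyset=\max\emptyset=-\infty$ and $\inf\emptyset=+\infty$) (a) $X=\operatorname{span}\{u-v: u,v\in G(E)\cup\{w_1,\dots,w_{d-k}\}\}$; (b) $\beta_j>\max_{1\le i\ne j\le d-k}\{\beta_i+\langle w_i,p_j-p_i\rangle\}$ for all $1\le j\le d-k$; (c) $\beta_j>\sup_{z\in E,\,|G(z)|\le N}\{f(z)+\langle G(z),p_j-z\rangle\}$ for all $1\le j\le d-k$ and all $N\in\mathbb{N}$; (d) $\inf_{x\in E,\,|P(x)|\le N}\bigl\{f(x)-\max_{1\le j\le d-k}\{\beta_j+\langle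 w_j,x-p_j\rangle\}\bigr\}>0$ for all $N\in\mathbb{N}$. (v) If $(x_k)_k,(z_k)_k$ are sequences in $E$ such that $(P(x_k))_k$ and $(G(z_k))_k$ are bounded and $$\lim_{k\to\infty}\bigl(f(x_k)-f(z_k)-\langle G(z_k),x_k-z_k\rangle\bigr)=0,$$ then $\lim_{k\to\infty}|G(x_k)-G(z_k)|=0$. -/

import Mathlib

open Filter Topology

/-- A real function on a normed space is essentially coercive if, up to subtracting a linear
function, it tends to `+∞` along every sequence whose norms tend to `+∞`. -/
def EssentiallyCoercive {Z : Type*} [NormedAddCommGroup Z] [NormedSpace ℝ Z] (c : Z → ℝ) : Prop :=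
  ∃ l : Z →ₗ[ℝ] ℝ, ∀ x : ℕ → Z, Tendsto (fun k => ‖x k‖) atTop atTop →
    Tendsto (fun k => c (x k) - l (x k)) atTop atTop

/-- `IsCoercivitySubspace F X` says that `X` is the subspace `X_F` of the canonical decomposition
`F(x) = c(P_X x) + ⟨v, x⟩`, with `v ∈ Xᗮ` and `c : X → ℝ` essentially coercive. There is at most
one such subspace (`IsCoercivitySubspace.unique`), so for a convex `F` this is `X_F = X`. -/
def IsCoercivitySubspace {n : ℕ} (F : EuclideanSpace ℝ (Fin n) → ℝ)
    (X : Submodule ℝ (EuclideanSpace ℝ (Fin n))) : Prop :=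
  ∃ v ∈ Xᗮ, ∃ c : X → ℝ, EssentiallyCoercive c ∧
    ∀ x, F x = c (X.orthogonalProjectionOnto x) + inner ℝ v x

theorem IsCoercivitySubspace.le {n : ℕ} {F : EuclideanSpace ℝ (Fin n) → ℝ}
    {X Y : Submodule ℝ (EuclideanSpace ℝ (Fin n))} (hX : IsCoercivitySubspace F X)
    (hY : IsCoercivitySubspace F Y) : X ≤ Y := by
  obtain ⟨v, hv, c, ⟨l, hl⟩, hF⟩ := hX
  obtain ⟨v', hv', c', -, hF'⟩ := hY
  rw [← Submodule.orthogonal_le_orthogonal_iff]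
  intro u hu
  set w : X := X.orthogonalProjectionOnto u with hw
  have hw0 : w = 0 := by
    by_contra hne
    have key : ∀ t : ℝ, c (t • w) - l (t • w)
        = c' 0 + t * (inner ℝ v' u - inner ℝ v u - l w) := by
      intro t
      have h1 := hF (t • u)
      have h2 := hF' (t • u)
      have hu0 : Y.orthogonalProjectionOnto u = 0 :=
        Submodule.orthogonalProjectionOnto_eq_zero_iff.2 hu
      simp only [map_smul, ← hw, hu0, smul_zero, inner_smul_right] at h1 h2
      rw [map_smul, smul_eq_mul]
      linarith
    have hnorm : 0 < ‖w‖ := norm_pos_iff.2 hne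
    have ht : Tendsto (fun k : ℕ => (k : ℝ) * ‖w‖) atTop atTop :=
      tendsto_natCast_atTop_atTop.atTop_mul_const hnorm
    have hp := hl (fun k => (k : ℝ) • w) (by simpa [norm_smul] using ht)
    have hm := hl (fun k => (-(k : ℝ)) • w) (by simpa [norm_smul] using ht)
    have hs := hp.atTop_add_atTop hm
    obtain ⟨k, hk⟩ := (hs.eventually_gt_atTop (2 * c' 0)).exists
    simp only [key] at hk
    linarith
  exact Submodule.orthogonalProjectionOnto_eq_zero_iff.1 hw0

theorem IsCoercivitySubspace.unique {n : ℕ} {F : EuclideanSpace ℝ (Fin n) → ℝ}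
    {X Y : Submodule ℝ (EuclideanSpace ℝ (Fin n))} (hX : IsCoercivitySubspace F X)
    (hY : IsCoercivitySubspace F Y) : X = Y :=
  le_antisymm (hX.le hY) (hY.le hX)

/-- The linear span of all differences of elements of `S`. -/
def diffSpan {n : ℕ} (S : Set (EuclideanSpace ℝ (Fin n))) :
    Submodule ℝ (EuclideanSpace ℝ (Fin n)) :=
  Submodule.span ℝ {y | ∃ u ∈ S, ∃ v ∈ S, y = u - v}

/-- The compatibility conditions (a)-(d) between the jet `(f, G)` on `E` and finitely many new jets
`(β j, w j)` at points `p j` outside the closure of `E`. Suprema and infima are taken in `EReal`,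
so that over the empty set they are `-∞` and `+∞`. -/
structure CompatibleJets {n : ℕ} {E : Set (EuclideanSpace ℝ (Fin n))}
    (X : Submodule ℝ (EuclideanSpace ℝ (Fin n))) (f : E → ℝ) (G : E → EuclideanSpace ℝ (Fin n))
    {m : ℕ} (p : Fin m → EuclideanSpace ℝ (Fin n)) (β : Fin m → ℝ)
    (w : Fin m → EuclideanSpace ℝ (Fin n)) : Prop where
  notMem_closure : ∀ j, p j ∉ closure E
  span_eq : X = diffSpan (Set.range G ∪ Set.range w)
  new_new : ∀ j i, i ≠ j → β i + inner ℝ (w i) (p j - p i) < β j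
  old_new : ∀ (j : Fin m) (N : ℕ),
    (⨆ z : {z : E // ‖G z‖ ≤ N}, ((f z + inner ℝ (G z) (p j - (z : E)) : ℝ) : EReal)) < (β j : EReal)
  new_old : ∀ N : ℕ,
    (0 : EReal) < ⨅ x : {x : E // ‖X.orthogonalProjectionOnto (x : EuclideanSpace ℝ (Fin n))‖ ≤ N},
      ((f x : EReal) - ⨆ j, ((β j + inner ℝ (w j) ((x : E) - p j) : ℝ) : EReal))

/-! Sufficiency. Adjoin the jets of (iv) to those of `E`, so that differences of slopes span `X`.
All slopes then share the same component `v` in `Xᗮ`; subtracting `⟨v, ·⟩` and projecting reduces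
the problem to jets on `X`. Let `m` be the supremum of their tangents. It is finite by (ii),
coercive up to a linear term by the spanning property (`exists_tendsto_tangentSup_sub`), and
differentiable on the closure of the data points, by (v) and the gaps in (b)-(d)
(`differentiableAt_tangentSup`). A differentiable majorant `g` equal to `m` on that closure has a
`C¹` convex envelope by coercivity (`differentiable_convexEnvelope`). The envelope lies between `m`
and `g`, so its values and slopes at the data are forced, and it inherits the coercivity of `m`.

Necessity. Modulo a linear term `F` factors through `X`, so its gradient depends only on the
projection and is uniformly continuous where the projection is bounded. Hence a tangent at `z` that
nearly touches the graph above `x` has nearly the slope at `x`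
(`IsCoercivitySubspace.exists_gradient_sub_lt`). This gives (v), and also the gaps (b)-(d) for
points whose gradients stay away from each other and from those on `E`; such points come from a
basis of `X` modulo `Y`. -/

/-! ### First-order calculus of convex functions. -/

section ConvexCalculus

variable {V : Type*} [NormedAddCommGroup V] [NormedSpace ℝ V]

/-- A convex function that is bounded above to first order by an affine function at a point is
differentiable there. -/
theorem ConvexOn.hasFDerivAt_of_le {F : V → ℝ} (hF : ConvexOn ℝ Set.univ F) {x : V}
    {L : V →L[ℝ] ℝ}
    (h : ∀ ε > 0, ∀ᶠ u in 𝓝 (0 : V), F (x + u) ≤ F x + L u + ε * ‖u‖) : HasFDerivAt F L x := by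
  rw [hasFDerivAt_iff_isLittleO_nhds_zero, Asymptotics.isLittleO_iff]
  intro ε hε
  have h1 := h ε hε
  have h2 : ∀ᶠ u in 𝓝 (0 : V), F (x + -u) ≤ F x + L (-u) + ε * ‖-u‖ := by
    have ht : Tendsto (fun u : V => -u) (𝓝 0) (𝓝 0) := by
      simpa using (continuous_neg (G := V)).tendsto 0
    exact ht.eventually h1
  filter_upwards [h1, h2] with u hu hu'
  have hmid := hF.2 (Set.mem_univ (x + u)) (Set.mem_univ (x + -u))
    (by norm_num : (0 : ℝ) ≤ 1 / 2) (by norm_num : (0 : ℝ) ≤ 1 / 2) (by norm_num)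
  have hx : (1 / 2 : ℝ) • (x + u) + (1 / 2 : ℝ) • (x + -u) = x := by module
  rw [hx, smul_eq_mul, smul_eq_mul] at hmid
  rw [map_neg, norm_neg] at hu'
  rw [Real.norm_eq_abs, abs_le]
  constructor <;> linarith

theorem ConvexOn.hasFDerivAt_of_touching_above {F ψ : V → ℝ} (hF : ConvexOn ℝ Set.univ F) {x : V}
    {L : V →L[ℝ] ℝ} (hψ : HasFDerivAt ψ L x) (hx : ψ x = F x) (hle : ∀ y, F y ≤ ψ y) :
    HasFDerivAt F L x := by
  refine hF.hasFDerivAt_of_le fun ε hε => ?_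
  rw [hasFDerivAt_iff_isLittleO_nhds_zero, Asymptotics.isLittleO_iff] at hψ
  filter_upwards [hψ hε] with u hu
  rw [Real.norm_eq_abs, abs_le] at hu
  linarith [hle (x + u), hu.2]

theorem ConvexOn.add_fderiv_le {F : V → ℝ} (hF : ConvexOn ℝ Set.univ F) {x : V}
    {L : V →L[ℝ] ℝ} (hL : HasFDerivAt F L x) (y : V) : F x + L (y - x) ≤ F y := by
  have hline : HasDerivAt (fun t : ℝ => F (x + t • (y - x))) (L (y - x)) 0 := by
    have hl : HasDerivAt (fun t : ℝ => x + t • (y - x)) (y - x) 0 := by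
      simpa using ((hasDerivAt_id (0 : ℝ)).smul_const (y - x)).const_add x
    have hL' : HasFDerivAt F L (x + (0 : ℝ) • (y - x)) := by simpa using hL
    exact hL'.comp_hasDerivAt 0 hl
  have hlim := hline.tendsto_slope_zero_right
  refine le_sub_iff_add_le'.1 (le_of_tendsto hlim ?_)
  filter_upwards [Ioo_mem_nhdsGT (zero_lt_one' ℝ)] with t ht
  have hc := hF.2 (Set.mem_univ x) (Set.mem_univ y) (by linarith [ht.2] : (0 : ℝ) ≤ 1 - t)
    ht.1.le (by ring)
  have he : (1 - t) • x + t • y = x + t • (y - x) := by module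
  rw [he, smul_eq_mul, smul_eq_mul] at hc
  simp only [zero_add, zero_smul, add_zero, smul_eq_mul]
  rw [inv_mul_le_iff₀ ht.1]
  linarith

theorem HasFDerivAt.eq_of_affine_le {F : V → ℝ} {x : V} {L M : V →L[ℝ] ℝ}
    (hL : HasFDerivAt F L x) (hM : ∀ y, F x + M (y - x) ≤ F y) : L = M := by
  have hd : HasFDerivAt (fun y => F y - M (y - x)) (L - M) x := by
    simp only [map_sub]
    exact hL.sub (M.hasFDerivAt.sub_const (M x))
  have hmin : IsLocalMin (fun y => F y - M (y - x)) x :=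
    Filter.Eventually.of_forall fun y => by
      simp only [sub_self, map_zero, sub_zero]
      linarith [hM y]
  exact sub_eq_zero.1 (hmin.hasFDerivAt_eq_zero hd)

/-- The tangent at `y` lies below the graph, so `F (y + u) - F y` bounds the derivative at `y` in
direction `u`. For `u` on a fixed small sphere and `y` near `x` this increment is close to the one
at `x`, hence to the derivative at `x`. -/
theorem ConvexOn.contDiff_one [FiniteDimensional ℝ V] {F : V → ℝ}
    (hF : ConvexOn ℝ Set.univ F) (hd : Differentiable ℝ F) : ContDiff ℝ 1 F := by
  rw [contDiff_one_iff_fderiv]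
  refine ⟨hd, continuous_iff_continuousAt.2 fun x => ?_⟩
  have : ProperSpace V := FiniteDimensional.proper_real V
  rw [Metric.continuousAt_iff]
  intro ε hε
  have hx := (hd x).hasFDerivAt
  rw [hasFDerivAt_iff_isLittleO_nhds_zero, Asymptotics.isLittleO_iff] at hx
  obtain ⟨r, hr, hxr⟩ := Metric.eventually_nhds_iff.1 (hx (show 0 < ε / 4 by positivity))
  set s := r / 2 with hs
  have hs0 : 0 < s := by positivity
  have huc : UniformContinuousOn F (Metric.closedBall x (s + 1)) :=
    (isCompact_closedBall x (s + 1)).uniformContinuousOn_of_continuous hd.continuous.continuousOn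
  -- Used twice, at the base points and at the shifted points: total error `ε / 4 * s`, matching the
  -- error `ε / 4 * s` from differentiability at `x`.
  obtain ⟨δ, hδ, hFδ⟩ := Metric.uniformContinuousOn_iff.1 huc (ε / 8 * s) (by positivity)
  refine ⟨min δ 1, by positivity, fun {y} hy => ?_⟩
  rw [dist_eq_norm]
  have hyδ : dist y x < δ := hy.trans_le (min_le_left _ _)
  have hy1 : dist y x < 1 := hy.trans_le (min_le_right _ _)
  have key : ∀ u : V, ‖u‖ = s → (fderiv ℝ F y - fderiv ℝ F x) u ≤ ε / 2 * ‖u‖ := by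
    intro u hu
    have h1 := hF.add_fderiv_le (hd y).hasFDerivAt (y + u)
    rw [add_sub_cancel_left] at h1
    have h2 := hxr (show dist u 0 < r by rw [dist_zero_right, hu, hs]; linarith)
    rw [Real.norm_eq_abs, abs_le] at h2
    have h3 := hFδ y (by rw [Metric.mem_closedBall]; linarith) x (by
      rw [Metric.mem_closedBall, dist_self]; linarith) hyδ
    have h4 := hFδ (y + u) (by
      rw [Metric.mem_closedBall]
      calc dist (y + u) x ≤ dist (y + u) y + dist y x := dist_triangle _ _ _
        _ ≤ s + 1 := by rw [dist_self_add_left, hu]; linarith) (x + u) (by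
      rw [Metric.mem_closedBall, dist_self_add_left, hu]; linarith) (by simpa using hyδ)
    rw [Real.dist_eq, abs_lt] at h3 h4
    rw [sub_apply]
    rw [hu] at h2 ⊢
    linarith [h2.2, h3.1, h4.2]
  refine lt_of_le_of_lt (ContinuousLinearMap.opNorm_le_bound _ (by positivity : 0 ≤ ε / 2) ?_)
    (by linarith)
  intro u
  rcases eq_or_ne u 0 with rfl | hu
  · simp
  have hu0 : 0 < ‖u‖ := norm_pos_iff.2 hu
  have key' : ∀ σ : ℝ, |σ| = 1 → σ * (fderiv ℝ F y - fderiv ℝ F x) u ≤ ε / 2 * ‖u‖ := by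
    intro σ hσ
    have hn : ‖(σ * s / ‖u‖) • u‖ = s := by
      rw [norm_smul, Real.norm_eq_abs, abs_div, abs_mul, hσ, abs_of_pos hs0, abs_norm]
      field_simp
    have := key _ hn
    rw [hn, map_smul, smul_eq_mul] at this
    have e : σ * s / ‖u‖ * (fderiv ℝ F y - fderiv ℝ F x) u
        = s * (σ * (fderiv ℝ F y - fderiv ℝ F x) u / ‖u‖) := by ring
    rw [e, mul_comm (ε / 2) s] at this
    have := le_of_mul_le_mul_left this hs0
    rwa [div_le_iff₀ hu0] at this
  rw [Real.norm_eq_abs, abs_le]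
  have h1 := key' 1 (by simp)
  have h2 := key' (-1) (by simp)
  constructor <;> linarith

end ConvexCalculus

/-! ### Differentiable majorants. -/

/-- A continuous function that is differentiable on a closed set `C` has a differentiable majorant
that agrees with it on `C`. -/
theorem exists_differentiable_majorant_eqOn {V : Type*} [NormedAddCommGroup V]
    [InnerProductSpace ℝ V] [FiniteDimensional ℝ V] {m : V → ℝ} (hm : Continuous m) {C : Set V}
    (hC : IsClosed C) (hd : ∀ x ∈ C, DifferentiableAt ℝ m x) :
    ∃ g : V → ℝ, Differentiable ℝ g ∧ (∀ x, m x ≤ g x) ∧ ∀ x ∈ C, g x = m x := by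
  classical
  -- `infDist` to the empty set is `0`, so the squeeze used below would degenerate.
  rcases C.eq_empty_or_nonempty with rfl | hne
  · obtain ⟨g, hg, hgm, -⟩ := (hm.add continuous_const).exists_contDiff_approx (F := ℝ)
      (f := fun x => m x + 1) (ε := fun _ => 1) 1 continuous_const (fun _ => one_pos)
    refine ⟨g, hg.differentiable (by simp), fun x => ?_, by simp⟩
    have := hgm x
    rw [Real.dist_eq, abs_lt] at this
    linarith [this.1]
  let U : TopologicalSpace.Opens V := ⟨Cᶜ, hC.isOpen_compl⟩
  have : ProperSpace V := FiniteDimensional.proper_real V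
  have : LocallyCompactSpace U := U.isOpen.locallyCompactSpace
  -- Approximating `m + ρ` within `ρ` off `C` places `g` between `m` and `m + infDist ^ 2`. The
  -- square makes the deviation from `m` negligible to first order at points of `C`.
  let ρ : V → ℝ := fun x => Metric.infDist x C ^ 2 / 2
  have hρ : Continuous ρ := by fun_prop
  have hpos : ∀ x : U, 0 < ρ x := fun x => by
    have : 0 < Metric.infDist (x : V) C := (hC.notMem_iff_infDist_pos hne).1 x.2
    positivity
  obtain ⟨g₀, hg₀, -⟩ := Continuous.exists_contMDiff_approx (M := U) (modelWithCornersSelf ℝ V)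
    (f := fun x : U => m x + ρ x) (ε := fun x : U => ρ x) 1
    ((hm.add hρ).comp continuous_subtype_val) (hρ.comp continuous_subtype_val) hpos
  let g : V → ℝ := fun x => if h : x ∈ Cᶜ then g₀ ⟨x, h⟩ else m x
  have hgU : ∀ x : U, g x = g₀ x := fun x => dif_pos x.2
  have hgC : ∀ x ∈ C, g x = m x := fun x hx => dif_neg (not_not_intro hx)
  have hbd : ∀ x, m x ≤ g x ∧ g x ≤ m x + Metric.infDist x C ^ 2 := by
    intro x
    by_cases hx : x ∈ C
    · rw [hgC x hx]
      exact ⟨le_rfl, by nlinarith [sq_nonneg (Metric.infDist x C)]⟩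
    · have := hg₀ ⟨x, hx⟩
      rw [← hgU, Real.dist_eq, abs_lt] at this
      have hr : ρ x = Metric.infDist x C ^ 2 / 2 := rfl
      simp only [hr] at this
      constructor <;> linarith [this.1, this.2]
  refine ⟨g, fun x => ?_, fun x => (hbd x).1, hgC⟩
  by_cases hx : x ∈ C
  · have hm' := (hd x hx).hasFDerivAt
    refine HasFDerivAt.differentiableAt (f' := fderiv ℝ m x) ?_
    rw [hasFDerivAt_iff_isLittleO_nhds_zero, Asymptotics.isLittleO_iff] at hm' ⊢
    intro ε hε
    filter_upwards [hm' (half_pos hε), Metric.ball_mem_nhds (0 : V) (half_pos hε)] with u hu hu'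
    rw [hgC x hx]
    obtain ⟨h1, h2⟩ := hbd (x + u)
    have h3 : Metric.infDist (x + u) C ≤ ‖u‖ := by
      simpa using Metric.infDist_le_dist_of_mem (x := x + u) hx
    have h4 : Metric.infDist (x + u) C ^ 2 ≤ ε / 2 * ‖u‖ := by
      rw [mem_ball_zero_iff] at hu'
      nlinarith [Metric.infDist_nonneg (x := x + u) (s := C), norm_nonneg u]
    rw [Real.norm_eq_abs, abs_le] at hu ⊢
    have := mul_nonneg hε.le (norm_nonneg u)
    constructor <;> linarith [hu.1, hu.2]
  · have h1 : ContMDiffAt (modelWithCornersSelf ℝ V) (modelWithCornersSelf ℝ ℝ) 1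
        (fun y : U => g y) ⟨x, hx⟩ := by
      simp only [hgU]
      exact g₀.contMDiff.contMDiffAt
    exact (contMDiffAt_subtype_iff.1 h1).contDiffAt.differentiableAt (by simp)

/-! ### Convex envelopes of differentiable functions. -/

section ConvexEnvelope

variable {V : Type*} [NormedAddCommGroup V] [NormedSpace ℝ V]

/-- The convex hull of the epigraph of a function. -/
def epigraphHull (g : V → ℝ) : Set (V × ℝ) := convexHull ℝ {p : V × ℝ | g p.1 ≤ p.2}

/-- The convex envelope of a function that has a convex minorant. -/
noncomputable def convexEnvelope (g : V → ℝ) (x : V) : ℝ := sInf {t | (x, t) ∈ epigraphHull g}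

theorem mk_mem_epigraphHull (g : V → ℝ) (x : V) : (x, g x) ∈ epigraphHull g :=
  subset_convexHull _ _ (le_refl (g x))

variable {m g : V → ℝ}

theorem le_of_mem_epigraphHull (hm : ConvexOn ℝ Set.univ m) (hmg : ∀ x, m x ≤ g x) {p : V × ℝ}
    (hp : p ∈ epigraphHull g) : m p.1 ≤ p.2 := by
  have h : epigraphHull g ⊆ {p : V × ℝ | p.1 ∈ Set.univ ∧ m p.1 ≤ p.2} :=
    convexHull_min (fun q hq => ⟨Set.mem_univ _, (hmg q.1).trans hq⟩) hm.convex_epigraph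
  exact (h hp).2

theorem bddBelow_epigraphHull (hm : ConvexOn ℝ Set.univ m) (hmg : ∀ x, m x ≤ g x) (x : V) :
    BddBelow {t | (x, t) ∈ epigraphHull g} :=
  ⟨m x, fun _ ht => le_of_mem_epigraphHull hm hmg ht⟩

theorem le_convexEnvelope (hm : ConvexOn ℝ Set.univ m) (hmg : ∀ x, m x ≤ g x) (x : V) :
    m x ≤ convexEnvelope g x :=
  le_csInf ⟨_, mk_mem_epigraphHull g x⟩ fun _ ht => le_of_mem_epigraphHull hm hmg ht

theorem convexEnvelope_le_of_mem (hm : ConvexOn ℝ Set.univ m) (hmg : ∀ x, m x ≤ g x) {x : V}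
    {t : ℝ} (h : (x, t) ∈ epigraphHull g) : convexEnvelope g x ≤ t :=
  csInf_le (bddBelow_epigraphHull hm hmg x) h

theorem exists_mem_epigraphHull_lt (g : V → ℝ) (x : V) {ε : ℝ} (hε : 0 < ε) :
    ∃ t, (x, t) ∈ epigraphHull g ∧ t < convexEnvelope g x + ε :=
  exists_lt_of_csInf_lt ⟨_, mk_mem_epigraphHull g x⟩ (lt_add_of_pos_right _ hε)

theorem convexOn_convexEnvelope (hm : ConvexOn ℝ Set.univ m) (hmg : ∀ x, m x ≤ g x) :
    ConvexOn ℝ Set.univ (convexEnvelope g) := by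
  refine ⟨convex_univ, fun x _ y _ a b ha hb hab => le_of_forall_pos_le_add fun ε hε => ?_⟩
  obtain ⟨s, hs, hs'⟩ := exists_mem_epigraphHull_lt g x hε
  obtain ⟨t, ht, ht'⟩ := exists_mem_epigraphHull_lt g y hε
  have := convexEnvelope_le_of_mem hm hmg (convex_convexHull ℝ _ hs ht ha hb hab)
  refine this.trans ?_
  simp only [smul_eq_mul]
  calc a * s + b * t ≤ a * (convexEnvelope g x + ε) + b * (convexEnvelope g y + ε) := by gcongr
    _ = a * convexEnvelope g x + b * convexEnvelope g y + (a + b) * ε := by ring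
    _ = _ := by rw [hab, one_mul]

/-- Up to `ε`, the envelope at `x` is attained by a convex combination with one large weight. -/
theorem exists_weight_of_convexEnvelope [FiniteDimensional ℝ V] (hm : ConvexOn ℝ Set.univ m)
    (hmg : ∀ x, m x ≤ g x) (ℓ : V →ₗ[ℝ] ℝ) {B : ℝ} (hB : ∀ x, B ≤ m x - ℓ x) (x : V) {ε : ℝ}
    (hε : 0 < ε) :
    ∃ a : ℝ, ∃ y : V, 1 / (Module.finrank ℝ V + 2 : ℝ) ≤ a ∧ a ≤ 1 ∧
      a * (g y - ℓ y - B) ≤ convexEnvelope g x + ε - ℓ x - B ∧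
      ∀ u, convexEnvelope g (x + u) ≤ convexEnvelope g x + ε + a * (g (y + a⁻¹ • u) - g y) := by
  classical
  obtain ⟨t, ht, htε⟩ := exists_mem_epigraphHull_lt g x hε
  -- Carathéodory in `V × ℝ`: at most `finrank V + 2` points are needed, so one weight is at least
  -- the reciprocal of that number.
  obtain ⟨ι, _, z, w, hz, hind, hw, hw1, hsum⟩ := eq_pos_convex_span_of_mem_convexHull ht
  replace hz : ∀ i, g (z i).1 ≤ (z i).2 := fun i => hz ⟨i, rfl⟩
  have hcard : (Fintype.card ι : ℝ) ≤ Module.finrank ℝ V + 2 := by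
    have h1 := hind.card_le_finrank_succ
    have h2 := (vectorSpan ℝ (Set.range z)).finrank_le
    rw [Module.finrank_prod, Module.finrank_self] at h2
    exact_mod_cast (by omega : Fintype.card ι ≤ Module.finrank ℝ V + 2)
  obtain ⟨i, hi⟩ : ∃ i, 1 / (Module.finrank ℝ V + 2 : ℝ) ≤ w i := by
    by_contra! hcon
    have hne : (Finset.univ : Finset ι).Nonempty := by
      rw [Finset.nonempty_iff_ne_empty]
      intro h
      rw [h, Finset.sum_empty] at hw1
      exact zero_ne_one hw1
    have h1 := Finset.sum_lt_sum_of_nonempty hne fun i _ => hcon i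
    rw [hw1, Finset.sum_const, Finset.card_univ, nsmul_eq_mul, mul_one_div,
      lt_div_iff₀ (by positivity)] at h1
    linarith
  have hx1 : ∑ j, w j • (z j).1 = x := by
    simpa [Prod.fst_sum] using congrArg Prod.fst hsum
  have hx2 : ∑ j, w j * (z j).2 = t := by
    simpa [Prod.snd_sum] using congrArg Prod.snd hsum
  refine ⟨w i, (z i).1, hi, ?_, ?_, fun u => ?_⟩
  · rw [← hw1]
    exact Finset.single_le_sum (fun j _ => (hw j).le) (Finset.mem_univ i)
  · have h0 : ∀ j, 0 ≤ (z j).2 - ℓ (z j).1 - B := fun j => by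
      linarith [hB (z j).1, hmg (z j).1, hz j]
    have h1 : w i * ((z i).2 - ℓ (z i).1 - B) ≤ ∑ j, w j * ((z j).2 - ℓ (z j).1 - B) :=
      Finset.single_le_sum (f := fun j => w j * ((z j).2 - ℓ (z j).1 - B))
        (fun j _ => mul_nonneg (hw j).le (h0 j)) (Finset.mem_univ i)
    have h2 : ∑ j, w j * ((z j).2 - ℓ (z j).1 - B) = t - ℓ x - B := by
      simp only [mul_sub, Finset.sum_sub_distrib, hx2, ← Finset.sum_mul, hw1, one_mul]
      rw [← hx1, map_sum]
      simp
    have h3 : w i * (g (z i).1 - ℓ (z i).1 - B) ≤ w i * ((z i).2 - ℓ (z i).1 - B) :=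
      mul_le_mul_of_nonneg_left (by linarith [hz i]) (hw i).le
    linarith
  -- Moving only the `i`-th point, by `d`, keeps it in the epigraph and shifts the barycentre by `w
  -- i • d`, whose first component is `u`.
  · set d : V × ℝ := ((w i)⁻¹ • u, g ((z i).1 + (w i)⁻¹ • u) - g (z i).1) with hd
    have hmem : ∑ j, w j • (z j + if j = i then d else 0) ∈ epigraphHull g := by
      refine (convex_convexHull ℝ _).sum_mem (fun j _ => (hw j).le) hw1 fun j _ => ?_
      refine subset_convexHull _ _ ?_
      by_cases hj : j = i
      · subst hj
        simp only [if_true, Set.mem_ofPred_eq, hd, Prod.fst_add, Prod.snd_add]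
        linarith [hz j]
      · simpa [hj] using hz j
    have hs : ∑ j, w j • (z j + if j = i then d else 0) = (x, t) + w i • d := by
      simp [smul_add, Finset.sum_add_distrib, hsum]
    rw [hs, hd, Prod.smul_mk, Prod.mk_add_mk, smul_inv_smul₀ (hw i).ne', smul_eq_mul] at hmem
    linarith [convexEnvelope_le_of_mem hm hmg hmem]

/-- Coercivity confines the heavily weighted points of near-optimal convex combinations to a ball. A
limit point `z` with weight `b > 0` yields a rescaled translate of `g` that lies above the envelope
and touches it at `x`; a convex function touched from above by a differentiable one is
differentiable there. -/
theorem differentiable_convexEnvelope [FiniteDimensional ℝ V] (hm : ConvexOn ℝ Set.univ m)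
    (hmg : ∀ x, m x ≤ g x) (hg : Differentiable ℝ g) (ℓ : V →ₗ[ℝ] ℝ)
    (hco : Tendsto (fun x => m x - ℓ x) (Bornology.cobounded V) atTop) :
    Differentiable ℝ (convexEnvelope g) := by
  intro x
  have : ProperSpace V := FiniteDimensional.proper_real V
  have hmc : Continuous m := continuousOn_univ.1 (hm.continuousOn isOpen_univ)
  have hℓc : Continuous ℓ := ℓ.continuous_of_finiteDimensional
  obtain ⟨B, hB⟩ : ∃ B, ∀ y, B ≤ m y - ℓ y := by
    obtain ⟨x₀, hx₀⟩ :=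
      (hmc.sub hℓc).exists_forall_le (by rwa [← Metric.cobounded_eq_cocompact])
    exact ⟨_, hx₀⟩
  set c : ℝ := 1 / (Module.finrank ℝ V + 2 : ℝ) with hc
  have hc0 : 0 < c := by positivity
  have hε : ∀ k : ℕ, 0 < 1 / (k + 1 : ℝ) := fun k => by positivity
  choose a y hca ha1 hay hau using fun k => exists_weight_of_convexEnvelope hm hmg ℓ hB x (hε k)
  set M : ℝ := c⁻¹ * (convexEnvelope g x + 1 - ℓ x - B) + B
  obtain ⟨R, hR⟩ : ∃ R : ℝ, ∀ z, m z - ℓ z ≤ M → ‖z‖ ≤ R := by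
    obtain ⟨R, -, hR⟩ := (Metric.hasBasis_cobounded_compl_closedBall (0 : V)).eventually_iff.1
      (hco.eventually_gt_atTop M)
    refine ⟨R, fun z hz => ?_⟩
    by_contra hcon
    exact (hR (x := z) (by simpa using hcon)).not_ge hz
  have hyR : ∀ k, y k ∈ Metric.closedBall (0 : V) R := by
    intro k
    rw [mem_closedBall_zero_iff]
    refine hR _ ?_
    have h1 : 1 / (k + 1 : ℝ) ≤ 1 := by
      rw [div_le_one (by positivity)]
      linarith [Nat.cast_nonneg (α := ℝ) k]
    have h2 : 0 ≤ g (y k) - ℓ (y k) - B := by linarith [hB (y k), hmg (y k)]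
    have h3 : c * (g (y k) - ℓ (y k) - B) ≤ convexEnvelope g x + 1 - ℓ x - B :=
      (mul_le_mul_of_nonneg_right (hca k) h2).trans (by linarith [hay k])
    have h4 := (le_inv_mul_iff₀ hc0).2 h3
    linarith [hmg (y k)]
  obtain ⟨⟨b, z⟩, hbz, φ, hφ, hlim⟩ := ((isCompact_Icc (a := c) (b := 1)).prod
    (isCompact_closedBall (0 : V) R)).tendsto_subseq (x := fun k => (a k, y k))
    fun k => ⟨⟨hca k, ha1 k⟩, hyR k⟩
  have hb0 : 0 < b := hc0.trans_le hbz.1.1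
  have hla : Tendsto (fun k => a (φ k)) atTop (𝓝 b) := (continuous_fst.tendsto _).comp hlim
  have hly : Tendsto (fun k => y (φ k)) atTop (𝓝 z) := (continuous_snd.tendsto _).comp hlim
  have hlim' : ∀ u, convexEnvelope g (x + u)
      ≤ convexEnvelope g x + b * (g (z + b⁻¹ • u) - g z) := by
    intro u
    have hε0 : Tendsto (fun k => 1 / ((φ k : ℕ) + 1 : ℝ)) atTop (𝓝 0) :=
      tendsto_one_div_add_atTop_nhds_zero_nat.comp hφ.tendsto_atTop
    have ht : Tendsto (fun k => convexEnvelope g x + 1 / ((φ k : ℕ) + 1 : ℝ)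
        + a (φ k) * (g (y (φ k) + (a (φ k))⁻¹ • u) - g (y (φ k)))) atTop
        (𝓝 (convexEnvelope g x + 0 + b * (g (z + b⁻¹ • u) - g z))) := by
      refine (hε0.const_add _).add (hla.mul (Tendsto.sub ?_ ((hg.continuous.tendsto _).comp hly)))
      exact (hg.continuous.tendsto _).comp (hly.add ((hla.inv₀ hb0.ne').smul_const u))
    rw [add_zero] at ht
    exact ge_of_tendsto' ht fun k => hau (φ k) u
  set ψ : V → ℝ := fun y => convexEnvelope g x + b * (g (z + b⁻¹ • (y - x)) - g z) with hψ
  have hψd : Differentiable ℝ ψ := by fun_prop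
  refine ((convexOn_convexEnvelope hm hmg).hasFDerivAt_of_touching_above (hψd x).hasFDerivAt
    (by simp [hψ]) fun y => ?_).differentiableAt
  simpa [hψ] using hlim' (y - x)

/-- Between a convex function that is coercive up to a linear term and a differentiable majorant
of it there is a convex `C¹` function. -/
theorem exists_convexOn_contDiff_between [FiniteDimensional ℝ V] (hm : ConvexOn ℝ Set.univ m)
    (hmg : ∀ x, m x ≤ g x) (hg : Differentiable ℝ g) (ℓ : V →ₗ[ℝ] ℝ)
    (hco : Tendsto (fun x => m x - ℓ x) (Bornology.cobounded V) atTop) :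
    ∃ F : V → ℝ, ConvexOn ℝ Set.univ F ∧ ContDiff ℝ 1 F ∧ (∀ x, m x ≤ F x) ∧ ∀ x, F x ≤ g x :=
  ⟨convexEnvelope g, convexOn_convexEnvelope hm hmg,
    (convexOn_convexEnvelope hm hmg).contDiff_one (differentiable_convexEnvelope hm hmg hg ℓ hco),
    le_convexEnvelope hm hmg,
    fun x => convexEnvelope_le_of_mem hm hmg (mk_mem_epigraphHull g x)⟩

end ConvexEnvelope

/-! ### Suprema of tangents. -/

section TangentSup

variable {V : Type*} [NormedAddCommGroup V] [InnerProductSpace ℝ V] {ι : Type*}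

/-- The supremum of the affine functions `x ↦ f i + ⟪G i, x - p i⟫`. -/
noncomputable def tangentSup (p : ι → V) (f : ι → ℝ) (G : ι → V) (x : V) : ℝ :=
  ⨆ i, (f i + inner ℝ (G i) (x - p i))

variable {p : ι → V} {f : ι → ℝ} {G : ι → V}

theorem le_tangentSup (hbdd : ∀ x, BddAbove (Set.range fun i => f i + inner ℝ (G i) (x - p i)))
    (i : ι) (x : V) : f i + inner ℝ (G i) (x - p i) ≤ tangentSup p f G x :=
  le_ciSup (hbdd x) i

theorem tangentSup_apply (hbdd : ∀ x, BddAbove (Set.range fun i => f i + inner ℝ (G i) (x - p i)))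
    (hle : ∀ i j, f j + inner ℝ (G j) (p i - p j) ≤ f i) (i : ι) :
    tangentSup p f G (p i) = f i := by
  have : Nonempty ι := ⟨i⟩
  refine le_antisymm (ciSup_le fun j => hle i j) ?_
  simpa using le_tangentSup hbdd i (p i)

theorem convexOn_tangentSup [Nonempty ι]
    (hbdd : ∀ x, BddAbove (Set.range fun i => f i + inner ℝ (G i) (x - p i))) :
    ConvexOn ℝ Set.univ (tangentSup p f G) := by
  refine ⟨convex_univ, fun x _ y _ a b ha hb hab => ciSup_le fun i => ?_⟩
  have h1 := mul_le_mul_of_nonneg_left (le_tangentSup hbdd i x) ha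
  have h2 := mul_le_mul_of_nonneg_left (le_tangentSup hbdd i y) hb
  simp only [smul_eq_mul, inner_sub_right, inner_add_right, inner_smul_right] at *
  have h3 : a * (f i - inner ℝ (G i) (p i)) + b * (f i - inner ℝ (G i) (p i))
      = f i - inner ℝ (G i) (p i) := by rw [← add_mul, hab, one_mul]
  linarith

/-- Affine functions that almost attain the supremum near a given point have bounded slopes. -/
theorem exists_norm_le_of_almost_maximal [FiniteDimensional ℝ V]
    (hbdd : ∀ x, BddAbove (Set.range fun i => f i + inner ℝ (G i) (x - p i)))
    (hcont : Continuous (tangentSup p f G)) (x : V) :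
    ∃ K, 0 ≤ K ∧ ∀ j y, dist y x ≤ 1 →
      tangentSup p f G y - 1 ≤ f j + inner ℝ (G j) (y - p j) → ‖G j‖ ≤ K := by
  have : ProperSpace V := FiniteDimensional.proper_real V
  obtain ⟨M, hM⟩ := (isCompact_closedBall x 2).exists_bound_of_continuousOn hcont.continuousOn
  have hM0 : 0 ≤ M := (norm_nonneg _).trans (hM x (by simp))
  refine ⟨2 * M + 1, by positivity, fun j y hy hj => ?_⟩
  rcases eq_or_ne (G j) 0 with h0 | h0
  · rw [h0, norm_zero]
    positivity
  -- A unit step along `G j` raises the affine function by `‖G j‖`, yet it stays below the supremum,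
  -- which is bounded by `M` on the ball of radius `2`.
  set u : V := ‖G j‖⁻¹ • G j with hu
  have hun : ‖u‖ = 1 := norm_smul_inv_norm h0
  have hin : inner ℝ (G j) u = ‖G j‖ := by
    rw [hu, inner_smul_right, real_inner_self_eq_norm_sq]
    field_simp
  have h1 := le_tangentSup hbdd j (y + u)
  have h2 := hM y (by rw [Metric.mem_closedBall]; linarith)
  have h3 := hM (y + u) (by
    rw [Metric.mem_closedBall]
    calc dist (y + u) x ≤ dist (y + u) y + dist y x := dist_triangle _ _ _
      _ ≤ 2 := by rw [dist_self_add_left, hun]; linarith)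
  rw [Real.norm_eq_abs, abs_le] at h2 h3
  rw [show y + u - p j = (y - p j) + u by abel, inner_add_right, hin] at h1
  linarith [h2.1, h3.2]

/-- A form of the first order compatibility of the jets `(f i, G i)` at the points `p i`, uniform on
bounded sets, under which the supremum of the tangents is differentiable at the points `p i`. -/
def UniformlyCompatible (p : ι → V) (f : ι → ℝ) (G : ι → V) : Prop :=
  ∀ R : ℝ, ∀ ε > 0, ∃ δ > 0, ∀ i j, ‖p i‖ ≤ R → ‖G j‖ ≤ R →
    f i - (f j + inner ℝ (G j) (p i - p j)) < δ → ‖G i - G j‖ < ε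

/-- Slopes at data points converging to `x` are bounded, hence subconverge to some `ξ`. By uniform
compatibility every tangent almost maximal at `x` has slope close to `ξ`. Tangents almost attaining
the supremum near `x` are of this kind, which gives the first-order upper bound with slope `ξ`. -/
theorem differentiableAt_tangentSup [FiniteDimensional ℝ V] [Nonempty ι]
    (hbdd : ∀ x, BddAbove (Set.range fun i => f i + inner ℝ (G i) (x - p i)))
    (hle : ∀ i j, f j + inner ℝ (G j) (p i - p j) ≤ f i)
    (huc : UniformlyCompatible p f G) {x : V} (hx : x ∈ closure (Set.range p)) :
    DifferentiableAt ℝ (tangentSup p f G) x := by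
  have : ProperSpace V := FiniteDimensional.proper_real V
  have hconv := convexOn_tangentSup hbdd
  have hcont : Continuous (tangentSup p f G) := continuousOn_univ.1 (hconv.continuousOn isOpen_univ)
  obtain ⟨K, hK0, hK⟩ := exists_norm_le_of_almost_maximal hbdd hcont x
  obtain ⟨q, hq, hqx⟩ := mem_closure_iff_seq_limit.1 hx
  choose i hi using hq
  obtain rfl : (fun k => p (i k)) = q := funext hi
  obtain ⟨N, hN⟩ := Metric.tendsto_atTop.1 hqx 1 one_pos
  have hGi : ∀ k, G (i (k + N)) ∈ Metric.closedBall (0 : V) K := fun k => by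
    rw [mem_closedBall_zero_iff]
    refine hK _ _ (hN (k + N) (by omega)).le ?_
    rw [tangentSup_apply hbdd hle, sub_self, inner_zero_right]
    linarith
  obtain ⟨ξ, -, φ, hφ, hξ⟩ := (isCompact_closedBall (0 : V) K).tendsto_subseq hGi
  have hpx : Tendsto (fun k => p (i (φ k + N))) atTop (𝓝 x) :=
    hqx.comp ((tendsto_add_atTop_nat N).comp hφ.tendsto_atTop)
  have hclose : ∀ ε > 0, ∃ δ > 0, ∀ j, ‖G j‖ ≤ K →
      tangentSup p f G x - (f j + inner ℝ (G j) (x - p j)) < δ → ‖ξ - G j‖ ≤ ε := by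
    intro ε hε
    -- `‖x‖ + 1` bounds the data points near `x`, and `K` bounds the slopes.
    obtain ⟨δ, hδ, h⟩ := huc (max (‖x‖ + 1) K) ε hε
    refine ⟨δ, hδ, fun j hj hjx => ?_⟩
    refine le_of_tendsto (hξ.sub_const (G j)).norm ?_
    have hev : Tendsto (fun k => f (i (φ k + N)) - (f j + inner ℝ (G j) (p (i (φ k + N)) - p j)))
        atTop (𝓝 (tangentSup p f G x - (f j + inner ℝ (G j) (x - p j)))) := by
      refine Tendsto.sub ?_ (((tendsto_const_nhds.inner (hpx.sub_const _))).const_add _)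
      simpa only [Function.comp_def, tangentSup_apply hbdd hle] using (hcont.tendsto x).comp hpx
    filter_upwards [hev.eventually_lt_const hjx] with k hk
    refine (h _ j (le_max_of_le_left ?_) (le_max_of_le_right hj) hk).le
    have := hN (φ k + N) (by omega)
    rw [dist_eq_norm] at this
    linarith [norm_sub_norm_le (p (i (φ k + N))) x]
  refine (hconv.hasFDerivAt_of_le (L := innerSL ℝ ξ) fun ε hε => ?_).differentiableAt
  obtain ⟨δ, hδ, hδ'⟩ := hclose (ε / 2) (half_pos hε)
  have hev : ∀ᶠ u in 𝓝 (0 : V), tangentSup p f G x - δ / 4 < tangentSup p f G (x + u) := by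
    have : Tendsto (fun u => tangentSup p f G (x + u)) (𝓝 0) (𝓝 (tangentSup p f G x)) := by
      simpa [Function.comp_def] using (hcont.comp (continuous_const_add x)).tendsto 0
    exact this.eventually_const_lt (by linarith)
  -- The deficit at `x` of the tangent `j` chosen below has three parts, each at most `δ / 4`: the
  -- drop of the supremum from `x` to `x + u`, the slack in the choice of `j`, and `K * ‖u‖`.
  have hr : 0 < min 1 (δ / (4 * (K + 1))) := by positivity
  filter_upwards [hev, Metric.ball_mem_nhds (0 : V) hr] with u hu hur
  rcases eq_or_ne u 0 with rfl | hu0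
  · simp
  have hu0 : 0 < ‖u‖ := norm_pos_iff.2 hu0
  rw [mem_ball_zero_iff, lt_min_iff, lt_div_iff₀ (by positivity)] at hur
  have hη : 0 < min (min 1 (δ / 4)) (ε / 2 * ‖u‖) := by positivity
  obtain ⟨j, hj⟩ := exists_lt_of_lt_ciSup
    (show tangentSup p f G (x + u) - min (min 1 (δ / 4)) (ε / 2 * ‖u‖)
      < ⨆ i, (f i + inner ℝ (G i) (x + u - p i)) from by
        change _ < tangentSup p f G (x + u); linarith)
  have m1 : min (min 1 (δ / 4)) (ε / 2 * ‖u‖) ≤ 1 := (min_le_left _ _).trans (min_le_left _ _)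
  have m2 : min (min 1 (δ / 4)) (ε / 2 * ‖u‖) ≤ δ / 4 := (min_le_left _ _).trans (min_le_right _ _)
  have m3 : min (min 1 (δ / 4)) (ε / 2 * ‖u‖) ≤ ε / 2 * ‖u‖ := min_le_right _ _
  have hGj : ‖G j‖ ≤ K := hK j (x + u) (by simpa using hur.1.le) (by linarith)
  have hsplit : (inner ℝ (G j) (x + u - p j) : ℝ) = inner ℝ (G j) (x - p j) + inner ℝ (G j) u := by
    rw [← inner_add_right]
    congr 1
    abel
  rw [hsplit] at hj
  have hGu : inner ℝ (G j) u ≤ K * ‖u‖ := (real_inner_le_norm _ _).trans (by gcongr)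
  have hnear := hδ' j hGj (by nlinarith)
  have hGξ : inner ℝ (G j) u ≤ inner ℝ ξ u + ε / 2 * ‖u‖ := by
    have : inner ℝ (G j - ξ) u ≤ ε / 2 * ‖u‖ := by
      refine (real_inner_le_norm _ _).trans ?_
      rw [norm_sub_rev]
      gcongr
    rw [inner_sub_left] at this
    linarith
  rw [innerSL_apply_apply]
  linarith [le_tangentSup hbdd j x]

/-- Finitely many slopes already have differences spanning the space. Relative to their barycentre
they sum to zero, so in every nonzero direction one of them is positive, and the maximum of the
corresponding affine functions grows linearly. -/
theorem exists_tendsto_tangentSup_sub [FiniteDimensional ℝ V] [Nonempty ι]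
    (hbdd : ∀ x, BddAbove (Set.range fun i => f i + inner ℝ (G i) (x - p i)))
    (hspan : ∀ u : V, (∀ i j, inner ℝ (G i - G j) u = 0) → u = 0) :
    ∃ ℓ : V →ₗ[ℝ] ℝ,
      Tendsto (fun x => tangentSup p f G x - ℓ x) (Bornology.cobounded V) atTop := by
  obtain ⟨i₀⟩ := ‹Nonempty ι›
  obtain ⟨d, e, he, hes⟩ : ∃ (d : ℕ) (e : Fin d → V), (∀ i, e i ∈ Set.range fun i => G i - G i₀) ∧
      Submodule.span ℝ (Set.range e) = Submodule.span ℝ (Set.range fun i => G i - G i₀) := by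
    obtain ⟨e, he, hes, -⟩ :=
      Submodule.exists_fun_fin_finrank_span_eq ℝ (Set.range fun i => G i - G i₀)
    exact ⟨_, e, he, hes⟩
  choose k hk using he
  let T : V →ₗ[ℝ] (Fin d → ℝ) := LinearMap.pi fun i => (innerSL ℝ (e i)).toLinearMap
  have hTapp : ∀ x i, T x i = inner ℝ (e i) x := fun x i => rfl
  have hker : LinearMap.ker T = ⊥ := by
    rw [LinearMap.ker_eq_bot']
    intro u hu
    have hG : ∀ i, inner ℝ (G i - G i₀) u = 0 := by
      intro i
      have hmem : G i - G i₀ ∈ Submodule.span ℝ (Set.range e) := by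
        rw [hes]
        exact Submodule.subset_span ⟨i, rfl⟩
      generalize G i - G i₀ = y at hmem ⊢
      induction hmem using Submodule.span_induction with
      | mem x hx =>
        obtain ⟨a, rfl⟩ := hx
        rw [← hTapp, hu, Pi.zero_apply]
      | zero => exact inner_zero_left _
      | add x y _ _ hx hy => rw [inner_add_left, hx, hy, add_zero]
      | smul a x _ hx => rw [inner_smul_left, hx, mul_zero]
    refine hspan u fun i j => ?_
    rw [← sub_sub_sub_cancel_right (G i) (G j) (G i₀), inner_sub_left, hG, hG, sub_zero]
  obtain ⟨c, hc, hT⟩ := T.exists_antilipschitzWith hker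
  -- The barycentre of the `d + 1` slopes `G i₀` and `G (k i) = G i₀ + e i`.
  set l : V := G i₀ + (1 / (d + 1 : ℝ)) • ∑ i, e i with hl
  set C : ℝ := |f i₀ - inner ℝ (G i₀) (p i₀)| + ∑ i, |f (k i) - inner ℝ (G (k i)) (p (k i))|
  have hC : ∀ x, ‖x‖ ≤ c * ((d + 1) * (tangentSup p f G x - inner ℝ l x + C)) := by
    intro x
    set D := tangentSup p f G x - inner ℝ l x + C with hD
    set s : ℝ := 1 / (d + 1 : ℝ) * ∑ i, inner ℝ (e i) x with hs
    have hs' : (d + 1) * s = ∑ i, inner ℝ (e i) x := by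
      rw [hs]
      field_simp
    have hlx : inner ℝ l x = inner ℝ (G i₀) x + s := by
      rw [hl, inner_add_left, real_inner_smul_left, sum_inner]
    have hD0 : -s ≤ D := by
      have h1 := le_tangentSup hbdd i₀ x
      have h2 : -(f i₀ - inner ℝ (G i₀) (p i₀)) ≤ C :=
        (neg_le_abs _).trans (le_add_of_nonneg_right (Finset.sum_nonneg fun _ _ => abs_nonneg _))
      rw [inner_sub_right] at h1
      linarith
    have hDi : ∀ i, 0 ≤ D + s - inner ℝ (e i) x := by
      intro i
      have h1 := le_tangentSup hbdd (k i) x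
      have h2 : -(f (k i) - inner ℝ (G (k i)) (p (k i))) ≤ C :=
        (neg_le_abs _).trans ((Finset.single_le_sum
          (f := fun i => |f (k i) - inner ℝ (G (k i)) (p (k i))|) (fun _ _ => abs_nonneg _)
          (Finset.mem_univ i)).trans (le_add_of_nonneg_left (abs_nonneg _)))
      have h3 : inner ℝ (e i) x = inner ℝ (G (k i)) x - inner ℝ (G i₀) x := by
        rw [← hk i, inner_sub_left]
      rw [inner_sub_right] at h1
      linarith
    -- The tangents give only upper bounds on the centred forms. Since these forms sum to zero,
    -- upper bounds on all of them imply the lower bounds as well.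
    have hsum : ∑ i, (D + s - inner ℝ (e i) x) = d * D - s := by
      rw [Finset.sum_sub_distrib, ← hs', Finset.sum_const, Finset.card_univ, Fintype.card_fin,
        nsmul_eq_mul]
      ring
    have hs1 : s ≤ d * D := by
      have := Finset.sum_nonneg fun i (_ : i ∈ Finset.univ) => hDi i
      linarith
    have hDnn : 0 ≤ D := by
      by_contra hneg
      push Not at hneg
      have : (d : ℝ) * D ≤ 0 := mul_nonpos_of_nonneg_of_nonpos (Nat.cast_nonneg d) hneg.le
      linarith
    have hbound : ‖T x‖ ≤ (d + 1) * D := by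
      refine (pi_norm_le_iff_of_nonneg (by positivity)).2 fun i => ?_
      have h1 := Finset.single_le_sum (fun i _ => hDi i) (Finset.mem_univ i)
      have h2 := hDi i
      rw [hTapp, Real.norm_eq_abs, abs_le]
      constructor <;> linarith
    have h1 := hT.le_mul_dist x 0
    rw [map_zero, dist_zero_right, dist_zero_right] at h1
    exact h1.trans (by gcongr)
  have hc' : (0 : ℝ) < c * (d + 1) := by
    have : (0 : ℝ) < c := hc
    positivity
  refine ⟨(innerSL ℝ l).toLinearMap, ?_⟩
  have ht : Tendsto (fun x : V => ‖x‖ / (c * (d + 1)) - C) (Bornology.cobounded V) atTop :=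
    tendsto_atTop_add_const_right _ _ (tendsto_norm_cobounded_atTop.atTop_div_const hc')
  refine tendsto_atTop_mono (fun x => ?_) ht
  have h1 : ‖x‖ / (c * (d + 1)) ≤ tangentSup p f G x - inner ℝ l x + C := by
    rw [div_le_iff₀ hc']
    linarith [hC x]
  change _ ≤ tangentSup p f G x - inner ℝ l x
  linarith

/-- Extension of jets whose slopes have differences spanning the whole space. -/
theorem exists_convexOn_contDiff_extension [FiniteDimensional ℝ V] [Nonempty ι]
    (hbdd : ∀ x, BddAbove (Set.range fun i => f i + inner ℝ (G i) (x - p i)))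
    (hle : ∀ i j, f j + inner ℝ (G j) (p i - p j) ≤ f i)
    (hspan : ∀ u : V, (∀ i j, inner ℝ (G i - G j) u = 0) → u = 0)
    (huc : UniformlyCompatible p f G) :
    ∃ F : V → ℝ, ConvexOn ℝ Set.univ F ∧ ContDiff ℝ 1 F ∧ (∀ i, F (p i) = f i) ∧
      (∀ i, HasFDerivAt F (innerSL ℝ (G i)) (p i)) ∧ EssentiallyCoercive F := by
  have hconv := convexOn_tangentSup hbdd
  obtain ⟨g, hg, hmg, hgC⟩ := exists_differentiable_majorant_eqOn
    (continuousOn_univ.1 (hconv.continuousOn isOpen_univ)) isClosed_closure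
    fun x hx => differentiableAt_tangentSup hbdd hle huc hx
  obtain ⟨ℓ, hℓ⟩ := exists_tendsto_tangentSup_sub hbdd hspan
  obtain ⟨F, hF, hF1, hmF, hFg⟩ := exists_convexOn_contDiff_between hconv hmg hg ℓ hℓ
  have hFf : ∀ i, F (p i) = f i := fun i => by
    have h1 := hmF (p i)
    have h2 := hFg (p i)
    rw [hgC _ (subset_closure ⟨i, rfl⟩)] at h2
    rw [← tangentSup_apply hbdd hle i]
    exact le_antisymm h2 h1
  refine ⟨F, hF, hF1, hFf, fun i => ?_, ℓ, fun x hx => ?_⟩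
  -- The prescribed tangent lies below `m`, hence below `F`, and meets `F` at `p i`, so it
  -- determines the derivative.
  · have hd := (hF1.differentiable (by simp) (p i)).hasFDerivAt
    rwa [hd.eq_of_affine_le (M := innerSL ℝ (G i)) fun y => by
      rw [hFf, innerSL_apply_apply]
      exact (le_tangentSup hbdd i y).trans (hmF y)] at hd
  · refine tendsto_atTop_mono (fun k => ?_)
      (hℓ.comp (tendsto_norm_atTop_iff_cobounded.1 hx))
    simpa using hmF (x k)

end TangentSup

/-! ### Sufficiency: extending the jets. -/

section Sufficiency

theorem exists_pos_forall_le {ι : Type*} [Finite ι] {d : ι → ℝ} (hd : ∀ i, 0 < d i) :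
    ∃ δ > 0, ∀ i, δ ≤ d i := by
  have h : ∀ᶠ δ in 𝓝[>] (0 : ℝ), ∀ i, δ ≤ d i :=
    eventually_all.2 fun i => by
      filter_upwards [Ioc_mem_nhdsGT (hd i)] with δ hδ using hδ.2
  obtain ⟨δ, h1, h2⟩ := (h.and self_mem_nhdsWithin).exists
  exact ⟨δ, h2, h1⟩

variable {n : ℕ} {E : Set (EuclideanSpace ℝ (Fin n))} {X : Submodule ℝ (EuclideanSpace ℝ (Fin n))}
  {f : E → ℝ} {G : E → EuclideanSpace ℝ (Fin n)}

/-- By (ii), tangents with large slope are nonpositive at `x`. The others have slope at most `R`, so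
at `x` they exceed their value at a fixed `x₀ ∈ E`, itself at most `f x₀`, by at most `R * ‖x -
x₀‖`. -/
theorem bddAbove_range_tangents
    (hle : ∀ x y : E, f y + inner ℝ (G y) ((x : EuclideanSpace ℝ (Fin n)) - y) ≤ f x)
    (hgrowth : ∀ x : ℕ → E, Tendsto (fun k => ‖G (x k)‖) atTop atTop →
      Tendsto (fun k =>
        (inner ℝ (G (x k)) (x k : EuclideanSpace ℝ (Fin n)) - f (x k)) / ‖G (x k)‖)
        atTop atTop) (x : EuclideanSpace ℝ (Fin n)) :
    BddAbove (Set.range fun z : E => f z + inner ℝ (G z) (x - z)) := by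
  rcases isEmpty_or_nonempty E with hE | ⟨⟨x₀⟩⟩
  · simp
  obtain ⟨R, hR0, hR⟩ : ∃ R : ℝ, 0 ≤ R ∧
      ∀ z : E, R ≤ ‖G z‖ → f z + inner ℝ (G z) (x - z) ≤ 0 := by
    by_contra! hcon
    choose z hz hz' using fun k : ℕ => hcon k (Nat.cast_nonneg k)
    have ht : Tendsto (fun k => ‖G (z k)‖) atTop atTop :=
      tendsto_atTop_mono hz tendsto_natCast_atTop_atTop
    obtain ⟨k, hk, hk0⟩ := (((hgrowth z ht).eventually_gt_atTop ‖x‖).and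
      (ht.eventually_gt_atTop 0)).exists
    rw [lt_div_iff₀ hk0] at hk
    have h1 := hz' k
    have h2 := real_inner_le_norm (G (z k)) x
    rw [inner_sub_right] at h1
    linarith [mul_comm ‖x‖ ‖G (z k)‖]
  refine ⟨max 0 (f x₀ + R * ‖x - x₀‖), ?_⟩
  rintro _ ⟨z, rfl⟩
  rcases le_total R ‖G z‖ with h | h
  · exact le_max_of_le_left (hR z h)
  · refine le_max_of_le_right ?_
    have h1 := hle x₀ z
    have h2 : inner ℝ (G z) (x - x₀) ≤ R * ‖x - x₀‖ :=
      (real_inner_le_norm _ _).trans (by gcongr)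
    have h3 : (inner ℝ (G z) (x - z) : ℝ)
        = inner ℝ (G z) ((x₀ : EuclideanSpace ℝ (Fin n)) - z) + inner ℝ (G z) (x - x₀) := by
      rw [← inner_add_right]
      congr 1
      abel
    change f z + inner ℝ (G z) (x - z) ≤ _
    linarith

theorem exists_uniform_of_sequential
    (hle : ∀ x y : E, f y + inner ℝ (G y) ((x : EuclideanSpace ℝ (Fin n)) - y) ≤ f x)
    (hseq : ∀ x z : ℕ → E,
      Bornology.IsBounded
        (Set.range fun k => X.orthogonalProjectionOnto (x k : EuclideanSpace ℝ (Fin n))) →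
      Bornology.IsBounded (Set.range fun k => G (z k)) →
      Tendsto (fun k =>
        f (x k) - f (z k) - inner ℝ (G (z k)) ((x k : EuclideanSpace ℝ (Fin n)) - z k))
        atTop (𝓝 0) →
      Tendsto (fun k => ‖G (x k) - G (z k)‖) atTop (𝓝 0)) (R : ℝ) {ε : ℝ} (hε : 0 < ε) :
    ∃ δ > 0, ∀ x z : E,
      ‖X.orthogonalProjectionOnto (x : EuclideanSpace ℝ (Fin n))‖ ≤ R → ‖G z‖ ≤ R →
      f x - (f z + inner ℝ (G z) ((x : EuclideanSpace ℝ (Fin n)) - z)) < δ → ‖G x - G z‖ < ε := by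
  by_contra! hcon
  choose x z hx hz hxz hG using fun k : ℕ => hcon (1 / (k + 1 : ℝ)) (by positivity)
  have hb1 : Bornology.IsBounded
      (Set.range fun k => X.orthogonalProjectionOnto (x k : EuclideanSpace ℝ (Fin n))) :=
    isBounded_iff_forall_norm_le.2 ⟨R, by rintro _ ⟨k, rfl⟩; exact hx k⟩
  have hb2 : Bornology.IsBounded (Set.range fun k => G (z k)) :=
    isBounded_iff_forall_norm_le.2 ⟨R, by rintro _ ⟨k, rfl⟩; exact hz k⟩
  have ht := hseq x z hb1 hb2 (squeeze_zero (fun k => by linarith [hle (x k) (z k)])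
    (fun k => by linarith [hxz k]) tendsto_one_div_add_atTop_nhds_zero_nat)
  obtain ⟨k, hk⟩ := (ht.eventually_lt_const hε).exists
  exact (hG k).not_gt hk

variable {m : ℕ} {p : Fin m → EuclideanSpace ℝ (Fin n)} {β : Fin m → ℝ}
  {w : Fin m → EuclideanSpace ℝ (Fin n)}

/-- A strict inequality in `EReal` leaves room for a real number, and finitely many `j` leave a
common positive gap. -/
theorem CompatibleJets.exists_gap_old_new (h : CompatibleJets X f G p β w) (R : ℝ) :
    ∃ δ > 0, ∀ j, ∀ z : E, ‖G z‖ ≤ R → δ ≤ β j - (f z + inner ℝ (G z) (p j - z)) := by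
  obtain ⟨N, hN⟩ := exists_nat_ge R
  choose r hr hr' using fun j => EReal.lt_iff_exists_real_btwn.1 (h.old_new j N)
  obtain ⟨δ, hδ, hδ'⟩ := exists_pos_forall_le (d := fun j => β j - r j)
    fun j => sub_pos.2 (EReal.coe_lt_coe_iff.1 (hr' j))
  refine ⟨δ, hδ, fun j z hz => ?_⟩
  have h1 : ((f z + inner ℝ (G z) (p j - z) : ℝ) : EReal) < r j :=
    (le_iSup (fun z : {z : E // ‖G z‖ ≤ N} =>
      ((f z + inner ℝ (G z) (p j - (z : E)) : ℝ) : EReal)) ⟨z, hz.trans hN⟩).trans_lt (hr j)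
  have h2 := EReal.coe_lt_coe_iff.1 h1
  linarith [hδ' j]

theorem CompatibleJets.exists_gap_new_old (h : CompatibleJets X f G p β w) (R : ℝ) :
    ∃ δ > 0, ∀ j, ∀ x : E, ‖X.orthogonalProjectionOnto (x : EuclideanSpace ℝ (Fin n))‖ ≤ R →
      δ ≤ f x - (β j + inner ℝ (w j) ((x : EuclideanSpace ℝ (Fin n)) - p j)) := by
  obtain ⟨N, hN⟩ := exists_nat_ge R
  obtain ⟨r, hr, hr'⟩ := EReal.lt_iff_exists_real_btwn.1 (h.new_old N)
  refine ⟨r, by exact_mod_cast hr, fun j x hx => ?_⟩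
  have h1 := hr'.le.trans (iInf_le _ ⟨x, hx.trans hN⟩)
  have h2 := h1.trans (EReal.sub_le_sub le_rfl
    (le_iSup (fun j => ((β j + inner ℝ (w j) ((x : E) - p j) : ℝ) : EReal)) j))
  exact_mod_cast h2

/-- Treats `Y = X` as the case of an empty family of new jets, so that one extension argument covers
both cases. -/
theorem CompatibleJets.of_eq (hX : diffSpan (Set.range G) = X)
    (p : Fin 0 → EuclideanSpace ℝ (Fin n)) (β : Fin 0 → ℝ) (w : Fin 0 → EuclideanSpace ℝ (Fin n)) :
    CompatibleJets X f G p β w where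
  notMem_closure j := j.elim0
  span_eq := by simp [hX]
  new_new j := j.elim0
  old_new j := j.elim0
  new_old N := by simp

theorem CompatibleJets.exists_extension (hE : E.Nonempty) (h : CompatibleJets X f G p β w)
    (hle : ∀ x y : E, f y + inner ℝ (G y) ((x : EuclideanSpace ℝ (Fin n)) - y) ≤ f x)
    (hbddE : ∀ x, BddAbove (Set.range fun z : E => f z + inner ℝ (G z) (x - z)))
    (hunif : ∀ R : ℝ, ∀ ε > 0, ∃ δ > 0, ∀ x z : E,
      ‖X.orthogonalProjectionOnto (x : EuclideanSpace ℝ (Fin n))‖ ≤ R → ‖G z‖ ≤ R →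
      f x - (f z + inner ℝ (G z) ((x : EuclideanSpace ℝ (Fin n)) - z)) < δ → ‖G x - G z‖ < ε) :
    ∃ F : EuclideanSpace ℝ (Fin n) → ℝ,
      ConvexOn ℝ Set.univ F ∧ ContDiff ℝ 1 F ∧ (∀ x : E, F x = f x) ∧
      (∀ x : E, gradient F x = G x) ∧ IsCoercivitySubspace F X := by
  obtain ⟨x₀, hx₀⟩ := hE
  set P := X.orthogonalProjectionOnto with hP
  -- Slopes differ by elements of `X`, so `v` is the `Xᗮ`-component of every one of them.
  set v : EuclideanSpace ℝ (Fin n) := G ⟨x₀, hx₀⟩ - P (G ⟨x₀, hx₀⟩) with hv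
  have hvX : v ∈ Xᗮ := X.sub_starProjection_mem_orthogonal _
  let q : E ⊕ Fin m → EuclideanSpace ℝ (Fin n) := Sum.elim (fun x => x) p
  let φ : E ⊕ Fin m → ℝ := Sum.elim f β
  let Γ : E ⊕ Fin m → EuclideanSpace ℝ (Fin n) := Sum.elim G w
  have hΓ : ∀ i, Γ i ∈ Set.range G ∪ Set.range w := by rintro (x | j) <;> simp [Γ]
  have hdiff : ∀ i j, Γ i - Γ j ∈ X := fun i j => by
    rw [h.span_eq]
    exact Submodule.subset_span ⟨_, hΓ i, _, hΓ j, rfl⟩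
  have hdec : ∀ i, (P (Γ i) : EuclideanSpace ℝ (Fin n)) + v = Γ i := by
    intro i
    have h1 := hdiff i (Sum.inl ⟨x₀, hx₀⟩)
    have h2 : (P (Γ i - G ⟨x₀, hx₀⟩) : EuclideanSpace ℝ (Fin n)) = Γ i - G ⟨x₀, hx₀⟩ :=
      congrArg Subtype.val (Submodule.orthogonalProjectionOnto_mem_subspace_eq_self ⟨_, h1⟩)
    rw [map_sub, Submodule.coe_sub] at h2
    rw [hv, ← sub_eq_zero]
    rw [← sub_eq_zero] at h2
    rw [← h2]
    abel
  have hinner : ∀ i y, inner ℝ (P (Γ i)) (P y) = inner ℝ (Γ i) y - inner ℝ v y := by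
    intro i y
    rw [hP, Submodule.inner_orthogonalProjectionOnto_eq_of_mem_left, ← hP]
    nth_rewrite 2 [← hdec i]
    rw [inner_add_left, add_sub_cancel_right]
  have hvx : ∀ x : X, inner ℝ v (x : EuclideanSpace ℝ (Fin n)) = 0 := fun x =>
    Submodule.inner_left_of_mem_orthogonal x.2 hvX
  have hPx : ∀ x : X, P x = x := Submodule.orthogonalProjectionOnto_mem_subspace_eq_self
  have htan : ∀ i (x : X), φ i - inner ℝ v (q i) + inner ℝ (P (Γ i)) (x - P (q i))
      = φ i + inner ℝ (Γ i) (x - q i) := by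
    intro i x
    rw [← hPx x, ← map_sub, hinner, inner_sub_right v, hPx, hvx]
    ring
  -- At `q j`, passing to the projected jets lowers every tangent and the value by the same `⟨v, q
  -- j⟩`, so all gaps are preserved.
  have htan' : ∀ i j, φ i - inner ℝ v (q i) + inner ℝ (P (Γ i)) (P (q j) - P (q i))
      = φ i + inner ℝ (Γ i) (q j - q i) - inner ℝ v (q j) := by
    intro i j
    rw [← map_sub, hinner, inner_sub_right v]
    ring
  have hleφ : ∀ i j, φ j + inner ℝ (Γ j) (q i - q j) ≤ φ i := by
    rintro (x | i) (z | j)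
    · exact hle x z
    · obtain ⟨δ, hδ, hgap⟩ := h.exists_gap_new_old ‖P (x : EuclideanSpace ℝ (Fin n))‖
      have : δ ≤ f x - (β j + inner ℝ (w j) (x - p j)) := hgap j x le_rfl
      change β j + inner ℝ (w j) (x - p j) ≤ f x
      linarith
    · obtain ⟨δ, hδ, hgap⟩ := h.exists_gap_old_new ‖G z‖
      have : δ ≤ β i - (f z + inner ℝ (G z) (p i - z)) := hgap i z le_rfl
      change f z + inner ℝ (G z) (p i - z) ≤ β i
      linarith
    · change β j + inner ℝ (w j) (p i - p j) ≤ β i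
      rcases eq_or_ne j i with rfl | hij
      · simp
      · exact (h.new_new i j hij).le
  have hnormΓ : ∀ i, ‖Γ i‖ ≤ ‖P (Γ i)‖ + ‖v‖ := fun i => by
    nth_rewrite 1 [← hdec i]
    exact norm_add_le _ _
  have hPdiff : ∀ i j, ‖P (Γ i) - P (Γ j)‖ = ‖Γ i - Γ j‖ := fun i j => by
    rw [← hdec i, ← hdec j, add_sub_add_right_eq_sub, ← Submodule.coe_sub, Submodule.coe_norm,
      hdec, hdec]
  -- Only two old jets need (v). In the mixed cases, and for two distinct new jets, the gap from
  -- (b)-(d) exceeds `δ`, so the premise fails. Undoing the projection enlarges the slope bound by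
  -- `‖v‖`.
  have huc : UniformlyCompatible (fun i => P (q i)) (fun i => φ i - inner ℝ v (q i))
      (fun i => P (Γ i)) := by
    intro R ε hε
    obtain ⟨δ₁, hδ₁, hoo⟩ := hunif (R + ‖v‖) ε hε
    obtain ⟨δ₂, hδ₂, hno⟩ := h.exists_gap_new_old R
    obtain ⟨δ₃, hδ₃, hon⟩ := h.exists_gap_old_new (R + ‖v‖)
    obtain ⟨δ₄, hδ₄, hnn⟩ := exists_pos_forall_le
      (ι := {ij : Fin m × Fin m // ij.1 ≠ ij.2})
      (d := fun ij => β ij.1.2 - (β ij.1.1 + inner ℝ (w ij.1.1) (p ij.1.2 - p ij.1.1)))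
      fun ij => sub_pos.2 (h.new_new _ _ ij.2)
    refine ⟨min (min δ₁ δ₂) (min δ₃ δ₄), by positivity, fun i j hi hj hij => ?_⟩
    rw [htan', hPdiff] at *
    have hj' : ‖Γ j‖ ≤ R + ‖v‖ := (hnormΓ j).trans (by linarith)
    simp only [lt_min_iff] at hij
    obtain ⟨⟨h1, h2⟩, h3, h4⟩ := hij
    rcases i with x | i <;> rcases j with z | j <;>
      simp only [q, φ, Γ, Sum.elim_inl, Sum.elim_inr] at *
    · refine hoo x z (hi.trans (by linarith [norm_nonneg v])) hj' (by linarith)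
    · have := hno j x hi
      linarith
    · have := hon i z hj'
      linarith
    · rcases eq_or_ne j i with rfl | hne
      · simpa using hε
      · have := hnn ⟨(j, i), hne⟩
        simp only at this
        linarith
  have hbdd : ∀ x : X, BddAbove (Set.range fun i =>
      φ i - inner ℝ v (q i) + inner ℝ (P (Γ i)) (x - P (q i))) := by
    intro x
    simp only [htan]
    obtain ⟨M₁, hM₁⟩ := hbddE x
    obtain ⟨M₂, hM₂⟩ := (Set.finite_range fun j =>
      β j + inner ℝ (w j) ((x : EuclideanSpace ℝ (Fin n)) - p j)).bddAbove
    refine ⟨max M₁ M₂, ?_⟩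
    rintro _ ⟨z | j, rfl⟩
    · exact le_max_of_le_left (hM₁ ⟨z, rfl⟩)
    · exact le_max_of_le_right (hM₂ ⟨j, rfl⟩)
  have hspan : ∀ u : X, (∀ i j, inner ℝ (P (Γ i) - P (Γ j)) u = 0) → u = 0 := by
    intro u hu
    have hall : ∀ y ∈ X, inner ℝ y (u : EuclideanSpace ℝ (Fin n)) = 0 := by
      intro y hy
      rw [h.span_eq] at hy
      induction hy using Submodule.span_induction with
      | mem y hy =>
        obtain ⟨a, ha, b, hb, rfl⟩ := hy
        obtain ⟨i, rfl⟩ : ∃ i, Γ i = a := by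
          rcases ha with ⟨x, rfl⟩ | ⟨j, rfl⟩
          exacts [⟨Sum.inl x, rfl⟩, ⟨Sum.inr j, rfl⟩]
        obtain ⟨j, rfl⟩ : ∃ i, Γ i = b := by
          rcases hb with ⟨x, rfl⟩ | ⟨j, rfl⟩
          exacts [⟨Sum.inl x, rfl⟩, ⟨Sum.inr j, rfl⟩]
        have := hu i j
        rw [Submodule.coe_inner, Submodule.coe_sub] at this
        rwa [← hdec i, ← hdec j, add_sub_add_right_eq_sub]
      | zero => exact inner_zero_left _
      | add a b _ _ ha hb => rw [inner_add_left, ha, hb, add_zero]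
      | smul a y _ hy => rw [inner_smul_left, hy, mul_zero]
    have := hall u u.2
    rwa [inner_self_eq_zero, Submodule.coe_eq_zero] at this
  have : Nonempty (E ⊕ Fin m) := ⟨Sum.inl ⟨x₀, hx₀⟩⟩
  obtain ⟨c, hc, hc1, hcf, hcd, hco⟩ := exists_convexOn_contDiff_extension hbdd
    (fun i j => by rw [htan']; linarith [hleφ i j]) hspan huc
  refine ⟨fun x => c (P x) + inner ℝ v x, ?_, ?_, fun x => ?_, fun x => ?_,
    v, hvX, c, hco, fun x => rfl⟩
  · refine ConvexOn.add ?_ ?_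
    · exact hc.comp_linearMap P.toLinearMap
    · exact (innerSL ℝ v).toLinearMap.convexOn convex_univ
  · exact (hc1.comp P.contDiff).add (contDiff_const.inner ℝ contDiff_id)
  · have := hcf (Sum.inl x)
    simp only [q, φ, Sum.elim_inl] at this
    simp only [this, sub_add_cancel]
  · have h1 := (hcd (Sum.inl x)).comp (x : EuclideanSpace ℝ (Fin n)) P.hasFDerivAt
    have h2 := h1.add (innerSL ℝ v).hasFDerivAt
    refine HasGradientAt.gradient (hasGradientAt_iff_hasFDerivAt.2 (h2.congr_fderiv ?_))
    ext y
    have h3 := hinner (Sum.inl x) y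
    simp only [Γ, Sum.elim_inl] at h3
    simp [Γ, h3]

end Sufficiency

/-! ### Necessity: gradients and the coercivity subspace. -/

section Necessity

/-- The image of `S` spans `X / Y`, so it contains a basis of that quotient; lift it to `S`.
Independence modulo `Y` keeps each lift, and each difference of two of them, out of `Y`. -/
theorem exists_fin_complement {V : Type*} [AddCommGroup V] [Module ℝ V] [FiniteDimensional ℝ V]
    {X Y : Submodule ℝ V} {S : Set V} (hYX : Y ≤ X) (hS : Y ⊔ Submodule.span ℝ S = X) :
    ∃ e : Fin (Module.finrank ℝ X - Module.finrank ℝ Y) → V, (∀ i, e i ∈ S) ∧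
      Y ⊔ Submodule.span ℝ (Set.range e) = X ∧ (∀ i, e i ∉ Y) ∧ ∀ i j, i ≠ j → e i - e j ∉ Y := by
  have hspan : Submodule.span ℝ (Y.mkQ '' S) = X.map Y.mkQ := by
    rw [← hS, Submodule.map_sup, Submodule.mkQ_map_self, bot_sup_eq, Submodule.map_span]
  have hfin : Module.finrank ℝ (Submodule.span ℝ (Y.mkQ '' S))
      = Module.finrank ℝ X - Module.finrank ℝ Y := by
    have h1 := (Y.mkQ ∘ₗ X.subtype).finrank_range_add_finrank_ker
    rw [LinearMap.range_comp, Submodule.range_subtype, LinearMap.ker_comp, Submodule.ker_mkQ] at h1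
    have h2 : Module.finrank ℝ (Y.comap X.subtype) = Module.finrank ℝ Y :=
      (Submodule.comapSubtypeEquivOfLe hYX).finrank_eq
    rw [hspan]
    omega
  obtain ⟨b, hb, hbs, hbi⟩ := Submodule.exists_fun_fin_finrank_span_eq ℝ (Y.mkQ '' S)
  rw [← hfin]
  choose e he heb using hb
  refine ⟨e, he, ?_, fun i hi => ?_, fun i j hij hmem => ?_⟩
  · rw [← Submodule.comap_map_mkQ, Submodule.map_span, ← Set.range_comp]
    have : ⇑Y.mkQ ∘ e = b := funext heb
    rw [this, hbs, hspan, Submodule.comap_map_mkQ, sup_eq_right.2 hYX]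
  · refine hbi.ne_zero i ?_
    rw [← heb, Submodule.mkQ_apply, Submodule.Quotient.mk_eq_zero]
    exact hi
  · refine hij (hbi.injective ?_)
    rw [← heb, ← heb]
    exact (Submodule.Quotient.eq Y).2 hmem

section Gradient

variable {V : Type*} [NormedAddCommGroup V] [InnerProductSpace ℝ V] [CompleteSpace V] {F : V → ℝ}

theorem ConvexOn.add_inner_gradient_le (hF : ConvexOn ℝ Set.univ F) (hd : Differentiable ℝ F)
    (x y : V) : F x + inner ℝ (gradient F x) (y - x) ≤ F y := by
  rw [inner_gradient_left]
  exact hF.add_fderiv_le (hd x).hasFDerivAt y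

theorem ContDiff.continuous_gradient (hF : ContDiff ℝ 1 F) : Continuous (gradient F) :=
  (InnerProductSpace.toDual ℝ V).symm.continuous.comp (hF.continuous_fderiv (by simp))

end Gradient

theorem diffSpan_mono {n : ℕ} {S T : Set (EuclideanSpace ℝ (Fin n))} (h : S ⊆ T) :
    diffSpan S ≤ diffSpan T :=
  Submodule.span_mono fun _ ⟨u, hu, v, hv, e⟩ => ⟨u, h hu, v, h hv, e⟩

theorem sub_mem_diffSpan {n : ℕ} {S : Set (EuclideanSpace ℝ (Fin n))}
    {u v : EuclideanSpace ℝ (Fin n)} (hu : u ∈ S) (hv : v ∈ S) : u - v ∈ diffSpan S :=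
  Submodule.subset_span ⟨u, hu, v, hv, rfl⟩

variable {n : ℕ} {X : Submodule ℝ (EuclideanSpace ℝ (Fin n))} {F : EuclideanSpace ℝ (Fin n) → ℝ}

theorem IsCoercivitySubspace.exists_add_eq (hX : IsCoercivitySubspace F X) :
    ∃ v : EuclideanSpace ℝ (Fin n), ∀ x, ∀ u ∈ Xᗮ, F (x + u) = F x + inner ℝ v u := by
  obtain ⟨v, -, c, -, hFc⟩ := hX
  refine ⟨v, fun x u hu => ?_⟩
  rw [hFc, hFc, map_add, Submodule.orthogonalProjectionOnto_eq_zero_iff.2 hu, add_zero,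
    inner_add_right]
  ring

/-- Translating by an element of `Xᗮ` changes `F` only by a constant. Hence compactness of balls
controls the gradient wherever the projection is bounded. -/
theorem IsCoercivitySubspace.gradient_orthogonalProjectionOnto (hX : IsCoercivitySubspace F X)
    (x : EuclideanSpace ℝ (Fin n)) :
    gradient F (X.orthogonalProjectionOnto x : EuclideanSpace ℝ (Fin n)) = gradient F x := by
  obtain ⟨v, hv⟩ := hX.exists_add_eq
  have hu : x - X.starProjection x ∈ Xᗮ := X.sub_starProjection_mem_orthogonal x
  set u := x - X.starProjection x with hudef
  have h1 : (fun y => F (y + u)) = fun y => F y + inner ℝ v u := funext fun y => hv y u hu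
  have h2 : fderiv ℝ F (X.starProjection x + u) = fderiv ℝ F (X.starProjection x) := by
    rw [← fderiv_comp_add_right, h1, fderiv_add_const]
  rw [hudef, add_sub_cancel] at h2
  rw [gradient, gradient, h2]
  rfl

theorem IsCoercivitySubspace.gradient_sub_mem (hX : IsCoercivitySubspace F X)
    (hF : ConvexOn ℝ Set.univ F) (hd : Differentiable ℝ F) (x y : EuclideanSpace ℝ (Fin n)) :
    gradient F x - gradient F y ∈ X := by
  obtain ⟨v, hv⟩ := hX.exists_add_eq
  have key : ∀ x, ∀ u ∈ Xᗮ, inner ℝ (gradient F x) u = inner ℝ v u := by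
    intro x u hu
    have h1 := hF.add_inner_gradient_le hd x (x + u)
    have h2 := hF.add_inner_gradient_le hd x (x + -u)
    rw [hv x u hu, add_sub_cancel_left] at h1
    rw [hv x (-u) (neg_mem hu), add_sub_cancel_left, inner_neg_right, inner_neg_right] at h2
    linarith
  rw [← Submodule.orthogonal_orthogonal X, Submodule.mem_orthogonal']
  intro u hu
  rw [inner_sub_left, key x u hu, key y u hu, sub_self]

/-- If the tangent at `z` almost touches the graph above `x`, then the slopes at `x` and `z` are
close, uniformly for `x` in a bounded set modulo `Xᗮ`. -/
theorem IsCoercivitySubspace.exists_gradient_sub_lt (hX : IsCoercivitySubspace F X)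
    (hF : ConvexOn ℝ Set.univ F) (hF1 : ContDiff ℝ 1 F) (R : ℝ) {ε : ℝ} (hε : 0 < ε) :
    ∃ δ > 0, ∀ x z, ‖X.orthogonalProjectionOnto x‖ ≤ R →
      F x - (F z + inner ℝ (gradient F z) (x - z)) < δ →
      ‖gradient F x - gradient F z‖ < ε := by
  have hd : Differentiable ℝ F := hF1.differentiable (by simp)
  have huc : UniformContinuousOn (gradient F) (Metric.closedBall 0 (R + 1)) :=
    (isCompact_closedBall _ _).uniformContinuousOn_of_continuous
      hF1.continuous_gradient.continuousOn
  obtain ⟨r, hr, hgr⟩ := Metric.uniformContinuousOn_iff.1 huc (ε / 2) (half_pos hε)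
  set s := min (r / 2) 1 with hs
  have hs0 : 0 < s := by positivity
  -- Take a step `u` of length `s` along `d`, the slope at `z` minus that at `x`. Comparing the
  -- tangents at `z` and at `x + u` gives `s * ‖d‖ < ε / 4 * s + ε / 2 * s`, the last term coming
  -- from the variation of the gradient between `x` and `x + u`.
  refine ⟨ε / 4 * s, by positivity, fun x z hx hxz => ?_⟩
  rcases eq_or_ne (gradient F x) (gradient F z) with heq | hne
  · rwa [heq, sub_self, norm_zero]
  set d := gradient F z - gradient F x with hdd
  have hd0 : 0 < ‖d‖ := norm_pos_iff.2 (sub_ne_zero.2 hne.symm)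
  set u := (s / ‖d‖) • d with hu
  have hun : ‖u‖ = s := by
    rw [hu, norm_smul, Real.norm_of_nonneg (by positivity)]
    field_simp
  have hdu : inner ℝ d u = s * ‖d‖ := by
    rw [hu, inner_smul_right, real_inner_self_eq_norm_sq]
    field_simp
  have h1 := hF.add_inner_gradient_le hd z (x + u)
  have h2 := hF.add_inner_gradient_le hd (x + u) x
  have hPu : ‖X.orthogonalProjectionOnto u‖ ≤ s := hun ▸ X.norm_orthogonalProjectionOnto_apply_le u
  have h3 : ‖gradient F (x + u) - gradient F x‖ < ε / 2 := by
    rw [← hX.gradient_orthogonalProjectionOnto (x + u), ← hX.gradient_orthogonalProjectionOnto x,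
      ← dist_eq_norm]
    refine hgr _ ?_ _ ?_ ?_
    · rw [mem_closedBall_zero_iff, ← Submodule.coe_norm, map_add]
      exact (norm_add_le _ _).trans (add_le_add hx (hPu.trans (min_le_right _ _)))
    · rw [mem_closedBall_zero_iff, ← Submodule.coe_norm]
      linarith
    · rw [dist_eq_norm, ← Submodule.coe_sub, ← Submodule.coe_norm, ← map_sub, add_sub_cancel_left]
      exact hPu.trans_lt ((min_le_left _ _).trans_lt (by linarith))
  have h4 : inner ℝ (gradient F (x + u) - gradient F x) u ≤ ε / 2 * s :=
    (real_inner_le_norm _ _).trans (by rw [hun]; gcongr)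
  rw [show x + u - z = (x - z) + u by abel, inner_add_right] at h1
  rw [show x - (x + u) = -u by abel, inner_neg_right] at h2
  rw [hdd, inner_sub_left] at hdu
  rw [inner_sub_left] at h4
  have h5 : s * ‖d‖ < s * ε := by
    have := mul_pos hε hs0
    linarith
  rw [norm_sub_rev]
  exact lt_of_mul_lt_mul_left h5 hs0.le

/-- If `u ∈ X` is orthogonal to all differences of gradients, then `F` is affine along `ℝ u`. For `u
≠ 0` this contradicts coercivity: the sum of the values at `t • u` and `-t • u` is constant after
removing any linear term. -/
theorem IsCoercivitySubspace.diffSpan_range_gradient (hX : IsCoercivitySubspace F X)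
    (hF : ConvexOn ℝ Set.univ F) (hd : Differentiable ℝ F) :
    diffSpan (Set.range (gradient F)) = X := by
  have hle : diffSpan (Set.range (gradient F)) ≤ X := by
    refine Submodule.span_le.2 ?_
    rintro _ ⟨_, ⟨x, rfl⟩, _, ⟨y, rfl⟩, rfl⟩
    exact hX.gradient_sub_mem hF hd x y
  have hbot : (diffSpan (Set.range (gradient F)))ᗮ ⊓ X = ⊥ := by
    rw [eq_bot_iff]
    rintro u ⟨hu, huX⟩
    obtain ⟨v, hv, c, ⟨l, hl⟩, hFc⟩ := hX
    by_contra hne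
    have hne : u ≠ 0 := hne
    set κ : ℝ := inner ℝ (gradient F 0) u
    have hκ : ∀ x, inner ℝ (gradient F x) u = κ := fun x => by
      have := Submodule.inner_right_of_mem_orthogonal
        (sub_mem_diffSpan (Set.mem_range_self x) (Set.mem_range_self 0)) hu
      rw [inner_sub_left] at this
      linarith
    have hline : ∀ t : ℝ, F (t • u) = F 0 + t * κ := by
      intro t
      have h1 := hF.add_inner_gradient_le hd 0 (t • u)
      have h2 := hF.add_inner_gradient_le hd (t • u) 0
      rw [sub_zero, inner_smul_right, hκ] at h1
      rw [zero_sub, inner_neg_right, inner_smul_right, hκ] at h2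
      linarith
    set u' : X := ⟨u, huX⟩ with hu'
    have hkey : ∀ t : ℝ, c (t • u') - l (t • u') = F 0 + t * (κ - l u') := by
      intro t
      have h1 := hFc (t • u)
      have h2 : X.orthogonalProjectionOnto u = u' :=
        Submodule.orthogonalProjectionOnto_mem_subspace_eq_self u'
      rw [hline, map_smul, h2, inner_smul_right, Submodule.inner_left_of_mem_orthogonal huX hv,
        mul_zero, add_zero] at h1
      rw [← h1, map_smul, smul_eq_mul]
      ring
    have hnorm : 0 < ‖u'‖ := norm_pos_iff.2 fun h => hne (congrArg Subtype.val h)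
    have ht : Tendsto (fun k : ℕ => (k : ℝ) * ‖u'‖) atTop atTop :=
      tendsto_natCast_atTop_atTop.atTop_mul_const hnorm
    have hp := hl (fun k => (k : ℝ) • u') (by simpa only [norm_smul, Real.norm_natCast] using ht)
    have hm := hl (fun k => (-(k : ℝ)) • u')
      (by simpa only [norm_smul, norm_neg, Real.norm_natCast] using ht)
    obtain ⟨k, hk⟩ := ((hp.atTop_add_atTop hm).eventually_gt_atTop (2 * F 0)).exists
    simp only [hkey] at hk
    linarith
  have := Submodule.sup_orthogonal_inf_of_hasOrthogonalProjection hle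
  rwa [hbot, sup_bot_eq] at this

/-- Evaluate the tangent at `x k` at the point of norm `R` in the direction of its slope. Since `F`
is at most `M` there, the numerator is at least `R` times the slope norm minus `M`, with `R`
arbitrary. -/
theorem ConvexOn.tendsto_inner_gradient_sub_div (hF : ConvexOn ℝ Set.univ F)
    (hd : Differentiable ℝ F) {x : ℕ → EuclideanSpace ℝ (Fin n)}
    (hx : Tendsto (fun k => ‖gradient F (x k)‖) atTop atTop) :
    Tendsto (fun k => (inner ℝ (gradient F (x k)) (x k) - F (x k)) / ‖gradient F (x k)‖)
      atTop atTop := by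
  refine tendsto_atTop.2 fun b => ?_
  set R := |b| + 1
  have hR : 0 ≤ R := by positivity
  obtain ⟨M, hM⟩ := (isCompact_closedBall (0 : EuclideanSpace ℝ (Fin n)) R
    ).exists_bound_of_continuousOn hd.continuous.continuousOn
  filter_upwards [hx.eventually_ge_atTop M, hx.eventually_gt_atTop 0] with k hkM hk0
  rw [le_div_iff₀ hk0]
  set g := gradient F (x k)
  have hun : ‖(R / ‖g‖) • g‖ = R := by
    rw [norm_smul, Real.norm_of_nonneg (by positivity)]
    field_simp
  have hin : inner ℝ g ((R / ‖g‖) • g) = R * ‖g‖ := by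
    rw [inner_smul_right, real_inner_self_eq_norm_sq]
    field_simp
  have h1 := hF.add_inner_gradient_le hd (x k) ((R / ‖g‖) • g)
  have h2 := (Real.le_norm_self _).trans (hM ((R / ‖g‖) • g) (by rw [mem_closedBall_zero_iff, hun]))
  rw [inner_sub_right, hin] at h1
  have h3 : b * ‖g‖ ≤ |b| * ‖g‖ := mul_le_mul_of_nonneg_right (le_abs_self b) hk0.le
  have h4 : R * ‖g‖ = |b| * ‖g‖ + ‖g‖ := by ring
  linarith

/-- A convex `C¹` function with coercivity subspace `X` provides the new jets that complete the span
of the slopes on `E` to `X`. -/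
theorem IsCoercivitySubspace.exists_compatibleJets (hX : IsCoercivitySubspace F X)
    (hF : ConvexOn ℝ Set.univ F) (hF1 : ContDiff ℝ 1 F) {E : Set (EuclideanSpace ℝ (Fin n))}
    (hE : E.Nonempty) :
    ∃ (p : Fin (Module.finrank ℝ X - Module.finrank ℝ
          (diffSpan (Set.range fun x : E => gradient F x))) → EuclideanSpace ℝ (Fin n)),
      CompatibleJets (E := E) X (fun x => F x) (fun x => gradient F x) p (fun j => F (p j))
        (fun j => gradient F (p j)) := by
  have hd : Differentiable ℝ F := hF1.differentiable (by simp)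
  obtain ⟨x₀, hx₀⟩ := hE
  set Y := diffSpan (Set.range fun x : E => gradient F x) with hY
  have hYE : ∀ x : E, gradient F x - gradient F x₀ ∈ Y := fun x =>
    sub_mem_diffSpan ⟨x, rfl⟩ ⟨⟨x₀, hx₀⟩, rfl⟩
  have hYX : Y ≤ X := by
    rw [← hX.diffSpan_range_gradient hF hd]
    exact diffSpan_mono (by rintro _ ⟨x, rfl⟩; exact ⟨x, rfl⟩)
  have hS : Y ⊔ Submodule.span ℝ (Set.range fun x => gradient F x - gradient F x₀) = X := by
    refine le_antisymm (sup_le hYX (Submodule.span_le.2 ?_)) (le_sup_of_le_right ?_)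
    · rintro _ ⟨x, rfl⟩
      exact hX.gradient_sub_mem hF hd x x₀
    · rw [← hX.diffSpan_range_gradient hF hd]
      refine Submodule.span_le.2 ?_
      rintro _ ⟨_, ⟨x, rfl⟩, _, ⟨y, rfl⟩, rfl⟩
      rw [← sub_sub_sub_cancel_right _ _ (gradient F x₀)]
      exact Submodule.sub_mem _ (Submodule.subset_span ⟨x, rfl⟩) (Submodule.subset_span ⟨y, rfl⟩)
  obtain ⟨e, heS, heX, heY, hee⟩ := exists_fin_complement hYX hS
  choose p hp using heS
  have hp : ∀ j, gradient F (p j) - gradient F x₀ = e j := hp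
  -- Relative to `gradient F x₀`, slopes on `E` lie in the closed subspace `Y` and the new one does
  -- not. This uniform separation produces the gaps in (c) and (d).
  have hdist : ∀ j, ∃ ε > 0, ∀ x : E, ε ≤ ‖gradient F (p j) - gradient F x‖ := by
    intro j
    refine ⟨Metric.infDist (e j) Y, ?_, fun x => ?_⟩
    · exact (Y.closed_of_finiteDimensional.notMem_iff_infDist_pos ⟨0, Y.zero_mem⟩).1 (heY j)
    · have := Metric.infDist_le_dist_of_mem (x := e j) (hYE x)
      rwa [dist_eq_norm, ← hp, sub_sub_sub_cancel_right, hp] at this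
  choose ε hε hεE using hdist
  refine ⟨p, ?_, ?_, ?_, ?_, ?_⟩
  · intro j hj
    have hclosed : IsClosed {x | gradient F x - gradient F x₀ ∈ Y} :=
      Y.closed_of_finiteDimensional.preimage (hF1.continuous_gradient.sub continuous_const)
    have hmem : gradient F (p j) - gradient F x₀ ∈ Y :=
      closure_minimal (fun x hx => hYE ⟨x, hx⟩) hclosed hj
    exact heY j (hp j ▸ hmem)
  · refine le_antisymm ?_ ?_
    · nth_rewrite 1 [← heX]
      refine sup_le (diffSpan_mono Set.subset_union_left) (Submodule.span_le.2 ?_)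
      rintro _ ⟨j, rfl⟩
      rw [← hp]
      exact sub_mem_diffSpan (Or.inr ⟨j, rfl⟩) (Or.inl ⟨⟨x₀, hx₀⟩, rfl⟩)
    · refine le_trans (diffSpan_mono ?_) (hX.diffSpan_range_gradient hF hd).le
      rintro _ (⟨x, rfl⟩ | ⟨j, rfl⟩)
      exacts [⟨x, rfl⟩, ⟨p j, rfl⟩]
  · intro j i hij
    have hne : gradient F (p j) - gradient F (p i) ≠ 0 := by
      rw [← sub_sub_sub_cancel_right _ _ (gradient F x₀), hp, hp]
      exact fun h => hee j i hij.symm (h ▸ Y.zero_mem)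
    obtain ⟨δ, hδ, h⟩ := hX.exists_gradient_sub_lt hF hF1 ‖X.orthogonalProjectionOnto (p j)‖
      (norm_pos_iff.2 hne)
    by_contra hcon
    exact lt_irrefl _ (h (p j) (p i) le_rfl (by linarith))
  · intro j N
    -- Only the point where the tangent is evaluated needs a bounded projection; here it is `p j`,
    -- so `δ` does not depend on `N`.
    obtain ⟨δ, hδ, h⟩ := hX.exists_gradient_sub_lt hF hF1 ‖X.orthogonalProjectionOnto (p j)‖ (hε j)
    refine lt_of_le_of_lt (b := ((F (p j) - δ : ℝ) : EReal)) (iSup_le fun z => ?_)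
      (EReal.coe_lt_coe_iff.2 (by linarith))
    refine EReal.coe_le_coe_iff.2 ?_
    by_contra hcon
    exact (hεE j z).not_gt (h (p j) z le_rfl (by linarith))
  · intro N
    choose δ hδ h using fun j => hX.exists_gradient_sub_lt hF hF1 (N : ℝ) (hε j)
    obtain ⟨η, hη, hηδ⟩ := exists_pos_forall_le hδ
    refine lt_of_lt_of_le (b := ((η : ℝ) : EReal)) (by exact_mod_cast hη) (le_iInf fun x => ?_)
    have hsup : ⨆ j, ((F (p j) + inner ℝ (gradient F (p j))
        (((x : E) : EuclideanSpace ℝ (Fin n)) - p j) : ℝ) : EReal)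
        ≤ ((F (x : E) - η : ℝ) : EReal) := by
      refine iSup_le fun j => EReal.coe_le_coe_iff.2 ?_
      by_contra hcon
      have := h j (x : E) (p j) x.2 (by linarith [hηδ j])
      rw [norm_sub_rev] at this
      exact (hεE j x).not_gt this
    refine le_trans ?_ (EReal.sub_le_sub le_rfl hsup)
    rw [← EReal.coe_sub, sub_sub_cancel]

end Necessity

/-! ### The characterization. -/

theorem mainTheorem1 {n : ℕ} (E : Set (EuclideanSpace ℝ (Fin n))) (hE : E.Nonempty)
    (X : Submodule ℝ (EuclideanSpace ℝ (Fin n)))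
    (f : E → ℝ) (G : E → EuclideanSpace ℝ (Fin n)) :
    (∃ F : EuclideanSpace ℝ (Fin n) → ℝ,
        ConvexOn ℝ Set.univ F ∧ ContDiff ℝ 1 F ∧
        (∀ x : E, F x = f x) ∧ (∀ x : E, gradient F x = G x) ∧
        IsCoercivitySubspace F X) ↔
      -- (i)
      (Continuous G ∧ ∀ x y : E, f y + inner ℝ (G y) ((x : EuclideanSpace ℝ (Fin n)) - y) ≤ f x) ∧
      -- (ii)
      (∀ x : ℕ → E, Tendsto (fun k => ‖G (x k)‖) atTop atTop →
        Tendsto (fun k =>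
          (inner ℝ (G (x k)) (x k : EuclideanSpace ℝ (Fin n)) - f (x k)) / ‖G (x k)‖)
          atTop atTop) ∧
      -- (iii)
      diffSpan (Set.range G) ≤ X ∧
      -- (iv)
      (diffSpan (Set.range G) ≠ X →
        ∃ (p : Fin (Module.finrank ℝ X - Module.finrank ℝ (diffSpan (Set.range G))) →
            EuclideanSpace ℝ (Fin n))
          (β : Fin (Module.finrank ℝ X - Module.finrank ℝ (diffSpan (Set.range G))) → ℝ)
          (w : Fin (Module.finrank ℝ X - Module.finrank ℝ (diffSpan (Set.range G))) →
            EuclideanSpace ℝ (Fin n)),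
          CompatibleJets X f G p β w) ∧
      -- (v)
      (∀ x z : ℕ → E,
        Bornology.IsBounded
          (Set.range fun k => X.orthogonalProjectionOnto (x k : EuclideanSpace ℝ (Fin n))) →
        Bornology.IsBounded (Set.range fun k => G (z k)) →
        Tendsto (fun k =>
          f (x k) - f (z k) - inner ℝ (G (z k)) ((x k : EuclideanSpace ℝ (Fin n)) - z k))
          atTop (𝓝 0) →
        Tendsto (fun k => ‖G (x k) - G (z k)‖) atTop (𝓝 0)) := by
  constructor
  · rintro ⟨F, hF, hF1, hFf, hFG, hX⟩
    have hd : Differentiable ℝ F := hF1.differentiable (by simp)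
    obtain rfl : (fun x : E => F x) = f := funext hFf
    obtain rfl : (fun x : E => gradient F x) = G := funext hFG
    refine ⟨⟨hF1.continuous_gradient.comp continuous_subtype_val,
      fun x y => hF.add_inner_gradient_le hd y x⟩,
      fun x hx => hF.tendsto_inner_gradient_sub_div hd hx, ?_, fun _ => ?_, ?_⟩
    · refine le_trans (diffSpan_mono ?_) (hX.diffSpan_range_gradient hF hd).le
      rintro _ ⟨x, rfl⟩
      exact ⟨x, rfl⟩
    · obtain ⟨p, hp⟩ := hX.exists_compatibleJets hF hF1 hE
      exact ⟨p, _, _, hp⟩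
    · intro x z hx _ hxz
      obtain ⟨R, hR⟩ := isBounded_iff_forall_norm_le.1 hx
      rw [Metric.tendsto_atTop]
      intro ε hε
      obtain ⟨δ, hδ, h⟩ := hX.exists_gradient_sub_lt hF hF1 R hε
      obtain ⟨N, hN⟩ := eventually_atTop.1 (hxz.eventually_lt_const hδ)
      refine ⟨N, fun k hk => ?_⟩
      rw [dist_zero_right, norm_norm]
      refine h _ _ (hR _ ⟨k, rfl⟩) ?_
      rw [← sub_sub]
      exact hN k hk
  · rintro ⟨⟨-, hle⟩, hgrowth, -, hjets, hseq⟩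
    have hbdd := bddAbove_range_tangents hle hgrowth
    have hunif := fun (R ε : ℝ) (hε : ε > 0) => exists_uniform_of_sequential hle hseq R hε
    by_cases hYX : diffSpan (Set.range G) = X
    · exact (CompatibleJets.of_eq (f := f) hYX Fin.elim0 Fin.elim0 Fin.elim0).exists_extension
        hE hle hbdd hunif
    · obtain ⟨p, β, w, h⟩ := hjets hYX
      exact h.exists_extension hE hle hbdd hunif
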